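/- **Setting.** There are $N$ devices with local objectives $F_1,\dots,F_N:\mathbb R^d\to\mathbb R$, each $L$-smooth and $\mu$-strongly convex ($L,\mu>0$), weights $p^k>0$ with $\sum_k p^k=1$, and $F=\sum_k p^kF_k$ with minimizer $w^*$. Put $F_k^*=\min F_k$, $\Gamma_k=F_k(w^*)-F_k^*$, $\Gamma=\sum_k p^k\Gamma_k$. Each round $\tau=0,1,\dots$ has $E\ge1$ time steps. In round $\tau$ every device starts from the global weight $w^{\mathcal G}_{\tau E}$, $w^k_{\tau E}=w^{\mathcal G}_{\tau E}$, and runs $w^k_{\tau E+i+1}=w^k_{\tau E+i}-\eta_\tau g^k_{\tau E+i}$ with stochastic gradients $g^k_t=\nabla F_k(w^k_t,\xi^k_t)$; it completes $s^k_\tau\in\{0,\dots,E\}$ of these updates, and $$w^{\mathcal G}_{(\tau+1)E}=w^{\mathcal G}_{\tau E}+\sum_{k=1}^N p^k_\tau\,\bigl(w^k_{\tau E+s^k_\tau}-w^{\mathcal G}_{\tau E}\bigr).$$ The mini-batches $\xi^k_t$ (over all $k,t$), the participation vectors $(s^k_\tau)_k$ (over all $\tau$) and the square-integrable initial weight $w^{\mathcal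 G}_0$ are independent (the $s^k_\tau$ of one round may depend on each other); $\mathbb E[\nabla F_k(w,\xi^k_t)]=\nabla F_k(w)$ for all $w$; and, along the run, $\mathbb E\|g^k_t-\nabla F_k(w^k_t)\|^2\le\sigma_k^2$ and $\mathbb E\|g_t^k\|^2\le G^2$ for all $k$ and $t$. **Schemes.** Let $K_\tau$ be the number of devices with $s^k_\tau=E$. * Scheme A: $p^k_\tau=Np^k/K_\tau$ if $s^k_\tau=E$, and $p^k_\tau=0$ otherwise; rounds with $K_\tau=0$ are discarded, so that $K_\tau\neq0$ almost surely in the retained rounds $\tau=0,1,\dots$. Put $\theta=N$. * Scheme B: $p^k_\tau=p^k$. Put $\theta=1$. * Scheme C: $p^k_\tau=Ep^k/s^k_\tau$ if $s^k_\tau\ne0$, and $p^k_\tau=0$ otherwise. Put $\theta=E$. Assume that $\mathbb E[p^k_\tau s^k_\tau]$ does not depend on $\tau$ and that $m:=\mathbb E[\sum_kp^k_\tau s^k_\tau]\ne0$. The learning rate is $$\eta_\tau=\frac{16E}{\mu m}\cdot\frac1{\tau E+\gamma},\qquad \gamma=\max\Bigl\{\frac{32E(1+\theta)L}{\mu m},\frac{4E^2\theta}{m}\Bigr\}.$$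 Put $D=\dfrac{64E\sum_k\mathbb E[p^k_\tau s^k_\tau]\,\Gamma_k}{\mu m}$, $\ \bar\sigma_N^2=\sum_k(p^k\sigma_k)^2$, and $\Delta_\tau=\mathbb E\|w^{\mathcal G}_{\tau E}-w^*\|^2$. Let $I_\tau$ be the indicator of the event that some device has $s^k_\tau=0$. Let $\rho=\sum_kp^k\,\mathbb P(s^k_\tau\ne0)$, which under Scheme C does not depend on $\tau$ and equals $1$ if all devices are active. Write $\mathbb E[1/s^k_\tau]$ for the expectation conditioned on $s^k_\tau\ne0$ (the plain expectation if device $k$ is always active). **Homogeneous participation** means that in each round all $s^k_\tau$ have the same distribution, with common expectations $\mathbb E[s_\tau]$ and $\mathbb E[1/s_\tau]$. For Scheme A it means moreover that the $s_\tau^k$ of a round are i.i.d. over $k$ before the rounds with $K_\tau=0$ are discarded, so that the retained rounds follow the i.i.d. law conditioned on $K_\tau\ne0$; $\mathbb E[N^2/K_\tau]$ is then the expectation under the conditioned law. **Corollary 4.1.** All $\Delta_\tau$ are finite, and there is a constant $C>0$ depending only on $E$, $L$, $\mu$ such that for all $\tau\ge1$ the following holds. 1. Homogeneous participation: $$\text{Scheme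 A:}\quad \Delta_\tau\le \frac{C}{\tau}\Bigl(\mathbb E\Bigl[\tfrac{N^2}{K_\tau}\Bigr](G^2+\Delta_0)+\bar\sigma_N^2+\Gamma\Bigr),$$ $$\text{Scheme B:}\quad \Delta_\tau\le \frac{C\,(\bar\sigma_N^2+\Gamma+G^2+\Delta_0)}{\tau\,\mathbb E[s_\tau]},$$ $$\text{Scheme C:}\quad \Delta_\tau\le \frac{C\,(\bar\sigma_N^2+\Gamma+G^2+\Delta_0)}{\tau\,\rho\,(\mathbb E[1/s_\tau])^{-1}}.$$ 2. Arbitrary (heterogeneous) participation. For Schemes A and B, $$\Delta_\tau\le \frac DE+\frac V\tau$$ for some $V$ not depending on $\tau$. For Scheme C, if $\mathbb E[s^k_\tau]\ne0$ for all $k$ and $\tau$, $$\Delta_\tau\le\frac C\tau\Bigl(\sum_{t=0}^{\tau-1}\mathbb E[I_t]\,D+\frac1\rho\Bigl(\sum_k(p^k\sigma_k)^2\,\mathbb E\Bigl[\tfrac1{s^k_\tau}\Bigr]+\Gamma+G^2+\Delta_0\Bigr)\Bigr).$$ 3. The bias of Schemes A and B need not vanish, even if all devices are active in all rounds: if $E\ge2$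 and $\mu\le L$, then for each of these two schemes there is a system satisfying all the assumptions, with $s_\tau^k\neq0$ always, and a $\delta>0$ such that $\Delta_\tau\ge\delta$ for all $\tau$. -/

import Mathlib

open MeasureTheory ProbabilityTheory Finset
open scoped BigOperators

noncomputable section

namespace FedAvg

/-- Model parameters. -/
abbrev Param (d : ℕ) : Type := EuclideanSpace ℝ (Fin d)

/-- The three aggregation schemes. -/
inductive Scheme : Type
  | A
  | B
  | C

/-- Number of complete devices (those with `v k = E`) for a participation vector `v`,
where `v k` is the number of local updates performed by device `k`. -/
def numComplete {N : ℕ} (E : ℕ) (v : Fin N → ℕ) : ℕ :=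
  (univ.filter fun k => v k = E).card

/-- Aggregation coefficient of device `k` when the participation vector of the round is `v`:
Scheme A uses `N p^k / K` on complete devices and `0` on the others, Scheme B uses `p^k`,
Scheme C uses `(E / v k) p^k`, and `0` if `v k = 0`. -/
def Scheme.coef {N : ℕ} (E : ℕ) (p : Fin N → ℝ) (v : Fin N → ℕ) (k : Fin N) : Scheme → ℝ
  | .A => if v k = E then (N : ℝ) * p k / (numComplete E v : ℝ) else 0
  | .B => p k
  | .C => if v k = 0 then 0 else (E : ℝ) / (v k : ℝ) * p k

/-- Upper bound `θ` of the ratio between the aggregation coefficient and `p^k`. -/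
def Scheme.theta (N E : ℕ) : Scheme → ℝ
  | .A => (N : ℝ)
  | .B => 1
  | .C => (E : ℝ)

/-- The data of a federated learning system with `N` devices and parameters in `ℝ^d`. -/
structure System (N d : ℕ) (Ω Ξ : Type*) [MeasurableSpace Ω] [MeasurableSpace Ξ] where
  /-- probability on the sample space -/
  P : Measure Ω
  /-- local objectives `F_k` -/
  F : Fin N → Param d → ℝ
  /-- weights `p^k` of the devices in the global objective -/
  p : Fin N → ℝ
  /-- stochastic gradient `∇F_k(w, ξ)` on the mini-batch `ξ` -/
  sgrad : Fin N → Param d → Ξ → Param d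
  /-- mini-batch of device `k` at time step `t` -/
  batch : Fin N → ℕ → Ω → Ξ
  /-- participation: `s τ ω k` is the number of local updates completed by `k` in round `τ` -/
  s : ℕ → Ω → Fin N → ℕ
  /-- initial global weight -/
  w0 : Ω → Param d

namespace System

/-- The global objective `F = ∑ p^k F_k`. -/
def globalF {N d : ℕ} {Ω Ξ : Type*} [MeasurableSpace Ω] [MeasurableSpace Ξ]
    (X : System N d Ω Ξ) (w : Param d) : ℝ :=
  ∑ k, X.p k * X.F k w

/-- `Γ_k = F_k(w*) - F_k^*`, with `F_k^*` the minimum value of `F_k`. -/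
def Gam {N d : ℕ} {Ω Ξ : Type*} [MeasurableSpace Ω] [MeasurableSpace Ξ]
    (X : System N d Ω Ξ) (wstar : Param d) (k : Fin N) : ℝ :=
  X.F k wstar - ⨅ w, X.F k w

/-- `Γ = ∑ p^k Γ_k`. -/
def GamTotal {N d : ℕ} {Ω Ξ : Type*} [MeasurableSpace Ω] [MeasurableSpace Ξ]
    (X : System N d Ω Ξ) (wstar : Param d) : ℝ :=
  ∑ k, X.p k * X.Gam wstar k

/-- `σ̄² = ∑ (p^k σ_k)²`. -/
def sigmaBarSq {N d : ℕ} {Ω Ξ : Type*} [MeasurableSpace Ω] [MeasurableSpace Ξ]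
    (X : System N d Ω Ξ) (σ : Fin N → ℝ) : ℝ :=
  ∑ k, (X.p k * σ k) ^ 2

/-- The expectation `𝔼[p_τ^k s_τ^k]`. -/
def meanWork {N d : ℕ} {Ω Ξ : Type*} [MeasurableSpace Ω] [MeasurableSpace Ξ]
    (X : System N d Ω Ξ) (E : ℕ) (sch : Scheme) (τ : ℕ) (k : Fin N) : ℝ :=
  ∫ ω, sch.coef E X.p (X.s τ ω) k * (X.s τ ω k : ℝ) ∂X.P

/-- The expectation `𝔼[∑_k p_τ^k s_τ^k]`, taken in round `0`; it is the same in all rounds under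
the standing assumptions below. -/
def totalWork {N d : ℕ} {Ω Ξ : Type*} [MeasurableSpace Ω] [MeasurableSpace Ξ]
    (X : System N d Ω Ξ) (E : ℕ) (sch : Scheme) : ℝ :=
  ∫ ω, ∑ k, sch.coef E X.p (X.s 0 ω) k * (X.s 0 ω k : ℝ) ∂X.P

/-- The shift `γ` of the learning rate. -/
def gam {N d : ℕ} {Ω Ξ : Type*} [MeasurableSpace Ω] [MeasurableSpace Ξ]
    (X : System N d Ω Ξ) (E : ℕ) (L μ : ℝ) (sch : Scheme) : ℝ :=
  max (32 * E * (1 + sch.theta N E) * L / (μ * X.totalWork E sch))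
    (4 * (E : ℝ) ^ 2 * sch.theta N E / X.totalWork E sch)

/-- The staircase learning rate `η_τ`. -/
def rate {N d : ℕ} {Ω Ξ : Type*} [MeasurableSpace Ω] [MeasurableSpace Ξ]
    (X : System N d Ω Ξ) (E : ℕ) (L μ : ℝ) (sch : Scheme) (τ : ℕ) : ℝ :=
  16 * E / (μ * X.totalWork E sch) * (1 / ((τ : ℝ) * E + X.gam E L μ sch))

/-- The bias constant `D`. -/
def bias {N d : ℕ} {Ω Ξ : Type*} [MeasurableSpace Ω] [MeasurableSpace Ξ]
    (X : System N d Ω Ξ) (E : ℕ) (μ : ℝ) (sch : Scheme) (wstar : Param d) : ℝ :=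
  64 * E * (∑ k, X.meanWork E sch 0 k * X.Gam wstar k) / (μ * X.totalWork E sch)

/-- Local SGD of device `k` with step size `η`, started at `w`, with mini-batches `b 0, b 1, …`:
the iterate after `i` steps. -/
def localIter {N d : ℕ} {Ω Ξ : Type*} [MeasurableSpace Ω] [MeasurableSpace Ξ]
    (X : System N d Ω Ξ) (η : ℝ) (k : Fin N) (w : Param d) (b : ℕ → Ξ) : ℕ → Param d
  | 0 => w
  | i + 1 => localIter X η k w b i - η • X.sgrad k (localIter X η k w b i) (b i)

/-- The global weight `w^𝒢_{τE}` at the beginning of round `τ`. -/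
def globalW {N d : ℕ} {Ω Ξ : Type*} [MeasurableSpace Ω] [MeasurableSpace Ξ]
    (X : System N d Ω Ξ) (E : ℕ) (L μ : ℝ) (sch : Scheme) : ℕ → Ω → Param d
  | 0, ω => X.w0 ω
  | τ + 1, ω => globalW X E L μ sch τ ω +
      ∑ k, sch.coef E X.p (X.s τ ω) k •
        (X.localIter (X.rate E L μ sch τ) k (globalW X E L μ sch τ ω)
            (fun i => X.batch k (τ * E + i) ω) (X.s τ ω k)
          - globalW X E L μ sch τ ω)

/-- The local weight `w_t^k` at the time step `t = τE + i`, `0 ≤ i < E`. -/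
def localW {N d : ℕ} {Ω Ξ : Type*} [MeasurableSpace Ω] [MeasurableSpace Ξ]
    (X : System N d Ω Ξ) (E : ℕ) (L μ : ℝ) (sch : Scheme) (t : ℕ) (k : Fin N) (ω : Ω) :
    Param d :=
  X.localIter (X.rate E L μ sch (t / E)) k (X.globalW E L μ sch (t / E) ω)
    (fun i => X.batch k (t / E * E + i) ω) (t % E)

/-- The stochastic gradient `g_t^k = ∇F_k(w_t^k, ξ_t^k)`. -/
def stochGrad {N d : ℕ} {Ω Ξ : Type*} [MeasurableSpace Ω] [MeasurableSpace Ξ]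
    (X : System N d Ω Ξ) (E : ℕ) (L μ : ℝ) (sch : Scheme) (t : ℕ) (k : Fin N) (ω : Ω) :
    Param d :=
  X.sgrad k (X.localW E L μ sch t k ω) (X.batch k t ω)

/-- The full-batch gradient `∇F_k(w_t^k)`. -/
def fullGrad {N d : ℕ} {Ω Ξ : Type*} [MeasurableSpace Ω] [MeasurableSpace Ξ]
    (X : System N d Ω Ξ) (E : ℕ) (L μ : ℝ) (sch : Scheme) (t : ℕ) (k : Fin N) (ω : Ω) :
    Param d :=
  gradient (X.F k) (X.localW E L μ sch t k ω)

/-- The mean squared distance `𝔼 ‖w^𝒢_{τE} - w*‖²`. -/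
def err {N d : ℕ} {Ω Ξ : Type*} [MeasurableSpace Ω] [MeasurableSpace Ξ]
    (X : System N d Ω Ξ) (E : ℕ) (L μ : ℝ) (sch : Scheme) (wstar : Param d) (τ : ℕ) : ℝ :=
  ∫ ω, ‖X.globalW E L μ sch τ ω - wstar‖ ^ 2 ∂X.P

/-- The expected number of local updates `𝔼[s_τ^k]`. -/
def meanS {N d : ℕ} {Ω Ξ : Type*} [MeasurableSpace Ω] [MeasurableSpace Ξ]
    (X : System N d Ω Ξ) (τ : ℕ) (k : Fin N) : ℝ :=
  ∫ ω, (X.s τ ω k : ℝ) ∂X.P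

/-- The expectation of `1 / s_τ^k`, conditioned on `k` being active (`s_τ^k ≠ 0`); it is the plain
expectation if `k` is active almost surely. -/
def meanInvS {N d : ℕ} {Ω Ξ : Type*} [MeasurableSpace Ω] [MeasurableSpace Ξ]
    (X : System N d Ω Ξ) (τ : ℕ) (k : Fin N) : ℝ :=
  ∫ ω, 1 / (X.s τ ω k : ℝ) ∂(ProbabilityTheory.cond X.P {ω | X.s τ ω k ≠ 0})

/-- The weighted activity level `∑ p^k ℙ(s_τ^k ≠ 0)`; it is `1` if all devices are active. -/
def activity {N d : ℕ} {Ω Ξ : Type*} [MeasurableSpace Ω] [MeasurableSpace Ξ]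
    (X : System N d Ω Ξ) (τ : ℕ) : ℝ :=
  ∑ k, X.p k * X.P.real {ω | X.s τ ω k ≠ 0}

/-- The expectation of `I_τ`, the indicator that some device is inactive in round `τ`. -/
def meanInactive {N d : ℕ} {Ω Ξ : Type*} [MeasurableSpace Ω] [MeasurableSpace Ξ]
    (X : System N d Ω Ξ) (τ : ℕ) : ℝ :=
  X.P.real {ω | ∃ k, X.s τ ω k = 0}

/-- The expectation of `N² / K_τ`. -/
def meanInvK {N d : ℕ} {Ω Ξ : Type*} [MeasurableSpace Ω] [MeasurableSpace Ξ]
    (X : System N d Ω Ξ) (E τ : ℕ) : ℝ :=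
  ∫ ω, (N : ℝ) ^ 2 / (numComplete E (X.s τ ω) : ℝ) ∂X.P

/-- Almost surely every (retained) round has a complete device. -/
def HasComplete {N d : ℕ} {Ω Ξ : Type*} [MeasurableSpace Ω] [MeasurableSpace Ξ]
    (X : System N d Ω Ξ) (E : ℕ) : Prop :=
  ∀ τ, ∀ᵐ ω ∂X.P, numComplete E (X.s τ ω) ≠ 0

/-- Homogeneous participation: in each round all `s_τ^k` have the same distribution. -/
def Homogeneous {N d : ℕ} {Ω Ξ : Type*} [MeasurableSpace Ω] [MeasurableSpace Ξ]
    (X : System N d Ω Ξ) : Prop :=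
  ∀ τ j k, X.P.map (fun ω => X.s τ ω j) = X.P.map (fun ω => X.s τ ω k)

/-- Homogeneous participation when rounds without a complete device are discarded: the devices
draw their numbers of updates independently from a common distribution, and the rounds that are
retained follow the law of the draw conditioned on `K_τ ≠ 0`. -/
def HomogeneousRetained {N d : ℕ} {Ω Ξ : Type*} [MeasurableSpace Ω] [MeasurableSpace Ξ]
    (X : System N d Ω Ξ) (E : ℕ) : Prop :=
  ∀ τ, ∃ ν : Measure ℕ, IsProbabilityMeasure ν ∧
    X.P.map (X.s τ) =
      ProbabilityTheory.cond (Measure.pi fun _ : Fin N => ν) {v | numComplete E v ≠ 0}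

/-- The standing assumptions on a system run with scheme `sch` and the learning rate above. -/
structure Standing {N d : ℕ} {Ω Ξ : Type*} [MeasurableSpace Ω] [MeasurableSpace Ξ]
    (X : System N d Ω Ξ) (E : ℕ) (L μ G : ℝ) (σ : Fin N → ℝ) (sch : Scheme)
    (wstar : Param d) : Prop where
  prob : IsProbabilityMeasure X.P
  p_pos : ∀ k, 0 < X.p k
  p_sum : ∑ k, X.p k = 1
  /-- each `F_k` is `L`-smooth -/
  diff : ∀ k, Differentiable ℝ (X.F k)
  smooth : ∀ k x y, ‖gradient (X.F k) x - gradient (X.F k) y‖ ≤ L * ‖x - y‖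
  /-- each `F_k` is `μ`-strongly convex -/
  strong : ∀ k, StrongConvexOn Set.univ μ (X.F k)
  /-- `w*` minimizes the global objective -/
  isMin : ∀ w, X.globalF wstar ≤ X.globalF w
  meas_sgrad : ∀ k, Measurable (Function.uncurry (X.sgrad k))
  meas_batch : ∀ k t, Measurable (X.batch k t)
  meas_s : ∀ τ, Measurable (X.s τ)
  meas_w0 : Measurable X.w0
  memLp_w0 : MemLp X.w0 2 X.P
  s_le : ∀ τ ω k, X.s τ ω k ≤ E
  /-- stochastic gradients are unbiased -/
  unbiased : ∀ k t w, Integrable (fun ω => X.sgrad k w (X.batch k t ω)) X.P ∧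
    ∫ ω, X.sgrad k w (X.batch k t ω) ∂X.P = gradient (X.F k) w
  /-- mini-batches, participation vectors of the rounds, and the initial weight are independent;
  the numbers of updates of different devices in the same round may be dependent -/
  indep_batch : iIndepFun (fun kt : Fin N × ℕ => X.batch kt.1 kt.2) X.P
  indep_s : iIndepFun X.s X.P
  indep_s_batch : IndepFun (fun ω (τ : ℕ) => X.s τ ω)
    (fun ω (kt : Fin N × ℕ) => X.batch kt.1 kt.2 ω) X.P
  indep_w0 : IndepFun X.w0
    (fun ω => ((fun τ : ℕ => X.s τ ω), (fun kt : Fin N × ℕ => X.batch kt.1 kt.2 ω))) X.P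
  /-- `𝔼[p_τ^k s_τ^k]` does not vary with time, and the sum over `k` does not vanish -/
  static : ∀ τ k, X.meanWork E sch τ k = X.meanWork E sch 0 k
  work_ne : X.totalWork E sch ≠ 0
  /-- bounded variance and bounded second moment of the stochastic gradients along the run -/
  variance : ∀ k t,
    Integrable (fun ω => ‖X.stochGrad E L μ sch t k ω - X.fullGrad E L μ sch t k ω‖ ^ 2) X.P ∧
    ∫ ω, ‖X.stochGrad E L μ sch t k ω - X.fullGrad E L μ sch t k ω‖ ^ 2 ∂X.P ≤ σ k ^ 2
  second_moment : ∀ k t,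
    Integrable (fun ω => ‖X.stochGrad E L μ sch t k ω‖ ^ 2) X.P ∧
    ∫ ω, ‖X.stochGrad E L μ sch t k ω‖ ^ 2 ∂X.P ≤ G ^ 2

end System

end FedAvg

end

/-! A round is a single stochastic gradient step with random weights. By `globalW_succ`, the global
weight moves by -η times the sum, over all devices k and all i < E, of `weight` times the stochastic
gradient; the weight is the coefficient of device k if it reaches step i, and 0 otherwise. The
weights depend on the participation vector of the round alone, which is independent of the gradients
and of the starting point. In expectation each weight may therefore be replaced by its mean
(`integral_weight_mul`), and for fixed k these means add up to 𝔼[p_τ^k s_τ^k]. Unbiasedness turns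
stochastic gradients into full gradients (`integral_inner_stochGrad`), evaluated at local weights
whose mean squared drift is at most (ηEG)². Smoothness and strong convexity then give the recursion
`err_succ_le`: a contraction of order ημm, noise of order η²m, and a term 2ηβ, where -β bounds ∑
𝔼[p_τ^k s_τ^k] (F_k(w) - F_k(w*)) from below.

Apart from m and θ, the schemes differ only in β. If the mean work is proportional to p^k, the sum
is a nonnegative multiple of F(w) - F(w*), so β = 0. This is the homogeneous case: by
exchangeability for Scheme A, by equality of laws for B and C. In general F_k(w) - F_k(w*) ≥ -Γ_k,
which produces D. For Scheme C the mean work is E p^k ℙ(active), so only inactivity creates a bias,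
and β acquires the factor 𝔼[I_τ] (`neg_meanInactive_mul_le`). `le_div_of_recursion` solves the
recursion for steps proportional to 1/(τE + γ). The resulting bounds involve G² + Δ_0 only; the
terms in σ_k and Γ are nonnegative and can be added.

Persistent bias is shown by a deterministic system of two quadratics on a line. One device makes E
steps and the other a single step, so the run stays in [0, 2/5] while the optimum is 1/2. -/

noncomputable section

/-! ### Strongly convex functions -/

section StrongConvexity

variable {V : Type*} [NormedAddCommGroup V] [InnerProductSpace ℝ V] [CompleteSpace V]
  {f : V → ℝ} {μ L : ℝ}

/-- First-order characterisation of strong convexity. -/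
theorem StrongConvexOn.add_inner_gradient_le (hf : StrongConvexOn Set.univ μ f)
    (hd : Differentiable ℝ f) (x y : V) :
    f x + inner ℝ (gradient f x) (y - x) + μ / 2 * ‖y - x‖ ^ 2 ≤ f y := by
  have hlin : HasDerivAt (fun t : ℝ => x + t • (y - x)) (y - x) 0 := by
    simpa using ((hasDerivAt_id (0 : ℝ)).smul_const (y - x)).const_add x
  have hder : HasDerivAt (fun t : ℝ => f (x + t • (y - x)))
      (inner ℝ (gradient f x) (y - x)) 0 := by
    have h1 : HasFDerivAt f (fderiv ℝ f (x + (0 : ℝ) • (y - x))) (x + (0 : ℝ) • (y - x)) :=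
      (hd _).hasFDerivAt
    have h2 := h1.comp_hasDerivAt (0 : ℝ) hlin
    have h3 : inner ℝ (gradient f x) (y - x) = fderiv ℝ f x (y - x) := by
      rw [inner_gradient_left]
    rw [h3]
    simpa [Function.comp_def] using h2
  have hslope := (hder.tendsto_slope_zero_right)
  -- Strong convexity on the segment, divided by t, bounds the secant slopes; t → 0+ then gives the
  -- gradient inequality with the full μ/2.
  have hle : ∀ᶠ t : ℝ in nhdsWithin 0 (Set.Ioi 0),
      t⁻¹ • (f (x + (0 + t) • (y - x)) - f (x + (0 : ℝ) • (y - x))) ≤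
        f y - f x - (1 - t) * (μ / 2 * ‖y - x‖ ^ 2) := by
    filter_upwards [Ioo_mem_nhdsGT (show (0 : ℝ) < 1 by norm_num)] with t ht
    have h := hf.2 (Set.mem_univ x) (Set.mem_univ y) (show 0 ≤ 1 - t by linarith [ht.2]) ht.1.le
      (by ring)
    have e1 : (1 - t) • x + t • y = x + (0 + t) • (y - x) := by
      rw [zero_add, smul_sub, sub_smul, one_smul]; abel
    rw [e1, norm_sub_rev x y] at h
    simp only [smul_eq_mul] at h ⊢
    rw [inv_mul_le_iff₀ ht.1]
    simp only [zero_smul, add_zero]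
    nlinarith [h]
  have hlim : Filter.Tendsto (fun t : ℝ => f y - f x - (1 - t) * (μ / 2 * ‖y - x‖ ^ 2))
      (nhdsWithin 0 (Set.Ioi 0)) (nhds (f y - f x - (1 - 0) * (μ / 2 * ‖y - x‖ ^ 2))) := by
    apply Filter.Tendsto.mono_left _ nhdsWithin_le_nhds
    apply Continuous.tendsto
    fun_prop
  have := le_of_tendsto_of_tendsto hslope hlim hle
  linarith

/-- Young's inequality absorbs the linear term of the first-order bound into the quadratic one.
Boundedness is what makes `⨅ w, X.F k w` a genuine lower bound, so that Γ_k ≥ 0. -/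
theorem StrongConvexOn.bddBelow_range (hf : StrongConvexOn Set.univ μ f) (hμ : 0 < μ)
    (hd : Differentiable ℝ f) : BddBelow (Set.range f) := by
  refine ⟨f 0 - ‖gradient f 0‖ ^ 2 / (2 * μ), ?_⟩
  rintro _ ⟨y, rfl⟩
  have h := hf.add_inner_gradient_le hd 0 y
  have h2 := abs_le.1 (abs_real_inner_le_norm (gradient f 0) (y - 0))
  have h3 : ‖gradient f 0‖ * ‖y - 0‖ ≤ ‖gradient f 0‖ ^ 2 / (2 * μ) + μ / 2 * ‖y - 0‖ ^ 2 := by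
    rw [div_add' _ _ _ (by positivity), le_div_iff₀ (by positivity)]
    nlinarith [sq_nonneg (‖gradient f 0‖ - μ * ‖y - 0‖)]
  linarith [h2.1]

/-- Lower bound for the correlation of the gradient at a point `v` near `w` with `w - z`. -/
theorem StrongConvexOn.le_inner_gradient_of_lipschitz (hf : StrongConvexOn Set.univ μ f)
    (hμ : 0 < μ) (hd : Differentiable ℝ f)
    (hL : ∀ x y, ‖gradient f x - gradient f y‖ ≤ L * ‖x - y‖) (v w z : V) :
    f w - f z + μ / 4 * ‖w - z‖ ^ 2 - L ^ 2 / μ * ‖v - w‖ ^ 2 ≤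
      inner ℝ (gradient f v) (w - z) := by
  have h := hf.add_inner_gradient_le hd w z
  have e : inner ℝ (gradient f v) (w - z) =
      inner ℝ (gradient f v - gradient f w) (w - z) - inner ℝ (gradient f w) (z - w) := by
    rw [inner_sub_left, ← neg_sub w z, inner_neg_right]; ring
  have h2 := abs_le.1 (abs_real_inner_le_norm (gradient f v - gradient f w) (w - z))
  -- Young's inequality is weighted to spend half of the available μ/2, leaving the μ/4 of the
  -- conclusion.
  have h3 : ‖gradient f v - gradient f w‖ * ‖w - z‖ ≤
      L ^ 2 / μ * ‖v - w‖ ^ 2 + μ / 4 * ‖w - z‖ ^ 2 := by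
    have h4 : ‖gradient f v - gradient f w‖ * ‖w - z‖ ≤ L * ‖v - w‖ * ‖w - z‖ :=
      mul_le_mul_of_nonneg_right (hL v w) (norm_nonneg _)
    refine h4.trans ?_
    have h5 : L ^ 2 / μ * ‖v - w‖ ^ 2 + μ / 4 * ‖w - z‖ ^ 2 - L * ‖v - w‖ * ‖w - z‖ =
        (L * ‖v - w‖ - μ / 2 * ‖w - z‖) ^ 2 / μ := by
      field_simp
      ring
    have h6 : 0 ≤ (L * ‖v - w‖ - μ / 2 * ‖w - z‖) ^ 2 / μ := by positivity
    linarith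
  rw [norm_sub_rev z w] at h
  linarith [h2.1]

end StrongConvexity

/-! ### Independence -/

section Independence

variable {Ω α β γ : Type*} {mΩ : MeasurableSpace Ω} [MeasurableSpace α] [MeasurableSpace β]
  [MeasurableSpace γ] {P : Measure Ω} [IsProbabilityMeasure P]

/-- The joint law is a triple product, and products of measures are associative. This allows
independent blocks to be adjoined one at a time. -/
theorem ProbabilityTheory.IndepFun.prodMk_right_of_prodMk_left {f : Ω → α} {g : Ω → β} {h : Ω → γ}
    (hf : Measurable f) (hg : Measurable g) (hh : Measurable h) (hfg : IndepFun f g P)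
    (hfgh : IndepFun (fun ω => (f ω, g ω)) h P) : IndepFun f (fun ω => (g ω, h ω)) P := by
  have hgh : IndepFun g h P := hfgh.comp measurable_snd measurable_id
  have := Measure.isProbabilityMeasure_map (μ := P) hf.aemeasurable
  have := Measure.isProbabilityMeasure_map (μ := P) hg.aemeasurable
  have := Measure.isProbabilityMeasure_map (μ := P) hh.aemeasurable
  rw [indepFun_iff_map_prod_eq_prod_map_map hf.aemeasurable (hg.prodMk hh).aemeasurable]
  rw [indepFun_iff_map_prod_eq_prod_map_map (hf.prodMk hg).aemeasurable hh.aemeasurable,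
    (indepFun_iff_map_prod_eq_prod_map_map hf.aemeasurable hg.aemeasurable).1 hfg] at hfgh
  rw [(indepFun_iff_map_prod_eq_prod_map_map hg.aemeasurable hh.aemeasurable).1 hgh]
  have := (measurePreserving_prodAssoc (P.map f) (P.map g) (P.map h)).map_eq
  rw [← this, ← hfgh, Measure.map_map MeasurableEquiv.prodAssoc.measurable (by fun_prop)]
  rfl

omit [IsProbabilityMeasure P] in
/-- If `f` is independent of `g`, then it is independent of every function that is measurable
with respect to `g`. -/
theorem ProbabilityTheory.IndepFun.of_measurable_comap_right {f : Ω → α} {g : Ω → β} {h : Ω → γ}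
    (hfg : IndepFun f g P) (hh : Measurable[MeasurableSpace.comap g inferInstance] h) :
    IndepFun f h P :=
  (IndepFun_iff_Indep _ _ _).2
    (indep_of_indep_of_le_right ((IndepFun_iff_Indep _ _ _).1 hfg) hh.comap_le)

/-- An inner product with a function of an independent noise may be replaced by the inner product
with the mean of that function over the noise. -/
theorem ProbabilityTheory.IndepFun.integral_inner_eq_of_mean
    {V : Type*} [NormedAddCommGroup V] [InnerProductSpace ℝ V] [CompleteSpace V]
    [MeasurableSpace V] [BorelSpace V] [SecondCountableTopology V]
    {ξ : Ω → α} {W U : Ω → V} (hξ : Measurable ξ) (hW : Measurable W) (hU : Measurable U)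
    (hind : IndepFun ξ (fun ω => (W ω, U ω)) P)
    {φ : V → α → V} (hφ : Measurable (Function.uncurry φ)) {g : V → V}
    (hmean : ∀ w, Integrable (fun ω => φ w (ξ ω)) P ∧ ∫ ω, φ w (ξ ω) ∂P = g w)
    (hint : Integrable (fun ω => (inner ℝ (φ (W ω) (ξ ω)) (U ω) : ℝ)) P) :
    ∫ ω, (inner ℝ (φ (W ω) (ξ ω)) (U ω) : ℝ) ∂P = ∫ ω, (inner ℝ (g (W ω)) (U ω) : ℝ) ∂P := by
  have := Measure.isProbabilityMeasure_map (μ := P) hξ.aemeasurable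
  have := Measure.isProbabilityMeasure_map (μ := P) (hW.prodMk hU).aemeasurable
  set ψ : (V × V) × α → ℝ := fun z => inner ℝ (φ z.1.1 z.2) z.1.2 with hψdef
  have hφ' : Measurable (fun z : (V × V) × α => φ z.1.1 z.2) :=
    hφ.comp (measurable_fst.fst.prodMk measurable_snd)
  have hψ : Measurable ψ := hφ'.inner measurable_fst.snd
  have hT : Measurable (fun ω => ((W ω, U ω), ξ ω)) := (hW.prodMk hU).prodMk hξ
  have hmap := (indepFun_iff_map_prod_eq_prod_map_map (hW.prodMk hU).aemeasurable
    hξ.aemeasurable).1 hind.symm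
  have hintψ : Integrable ψ ((P.map fun ω => (W ω, U ω)).prod (P.map ξ)) := by
    rw [← hmap, integrable_map_measure hψ.aestronglyMeasurable hT.aemeasurable]
    exact hint
  have h1 : ∫ ω, (inner ℝ (φ (W ω) (ξ ω)) (U ω) : ℝ) ∂P =
      ∫ z, ψ z ∂((P.map fun ω => (W ω, U ω)).prod (P.map ξ)) := by
    rw [← hmap, integral_map hT.aemeasurable hψ.aestronglyMeasurable]
  have hmean' : ∀ w, Integrable (φ w) (P.map ξ) ∧ ∫ x, φ w x ∂(P.map ξ) = g w := by
    intro w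
    have hm : Measurable (φ w) := hφ.comp (measurable_const.prodMk measurable_id)
    rw [integral_map hξ.aemeasurable hm.aestronglyMeasurable,
      integrable_map_measure hm.aestronglyMeasurable hξ.aemeasurable]
    exact hmean w
  have h2 : ∀ z : V × V, ∫ x, ψ (z, x) ∂(P.map ξ) = inner ℝ (g z.1) z.2 := by
    intro z
    have h3 := integral_inner (𝕜 := ℝ) (hmean' z.1).1 z.2
    rw [(hmean' z.1).2] at h3
    rw [real_inner_comm, ← h3]
    exact integral_congr_ae (Filter.Eventually.of_forall fun x => real_inner_comm _ _)
  rw [h1, integral_prod _ hintψ]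
  simp_rw [h2]
  -- No measurability of `g` is assumed; the inner product is measurable as the integral of `ψ` over
  -- the noise.
  have hg : StronglyMeasurable (fun z : V × V => (inner ℝ (g z.1) z.2 : ℝ)) := by
    simp_rw [← h2]
    exact hψ.stronglyMeasurable.integral_prod_right
  rw [integral_map (hW.prodMk hU).aemeasurable hg.aestronglyMeasurable]

end Independence

namespace FedAvg

/-! ### Aggregation coefficients -/

section Coefficients

variable {N E : ℕ} {p : Fin N → ℝ} {v : Fin N → ℕ}

theorem numComplete_pos {k : Fin N} (h : v k = E) : 0 < numComplete E v :=
  card_pos.2 ⟨k, by simp [h]⟩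

theorem numComplete_le : numComplete E v ≤ N :=
  (card_le_univ _).trans (by simp)

theorem Scheme.coef_nonneg (hp : ∀ k, 0 < p k) (sch : Scheme) (k : Fin N) :
    0 ≤ sch.coef E p v k := by
  have := (hp k).le
  cases sch <;> simp only [Scheme.coef] <;> (try split_ifs) <;> positivity

/-- Whenever the coefficient is nonzero its denominator is at least 1: under Scheme A device k is
itself counted among the complete ones, and under Scheme C it has made at least one update. -/
theorem Scheme.coef_le (hE : 0 < E) (hp : ∀ k, 0 < p k) (sch : Scheme) (k : Fin N) :
    sch.coef E p v k ≤ sch.theta N E * p k := by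
  have hk := (hp k).le
  cases sch with
  | A =>
    simp only [Scheme.coef, Scheme.theta]
    split_ifs with h
    · have : (1 : ℝ) ≤ numComplete E v := by exact_mod_cast numComplete_pos h
      exact div_le_self (by positivity) this
    · positivity
  | B => simp [Scheme.coef, Scheme.theta]
  | C =>
    simp only [Scheme.coef, Scheme.theta]
    split_ifs with h
    · positivity
    · have : (1 : ℝ) ≤ v k := by exact_mod_cast Nat.one_le_iff_ne_zero.2 h
      exact mul_le_mul_of_nonneg_right (div_le_self (by positivity) this) hk

theorem Scheme.one_le_theta (hN : 0 < N) (hE : 0 < E) (sch : Scheme) :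
    1 ≤ sch.theta N E := by
  cases sch <;> simp only [Scheme.theta, le_refl] <;> exact_mod_cast (by assumption)

end Coefficients

namespace System

/-! ### Rounds as weighted sums of stochastic gradients -/

section Run

variable {N d : ℕ} {Ω Ξ : Type*} [MeasurableSpace Ω] [MeasurableSpace Ξ]
  (X : System N d Ω Ξ) {E : ℕ} {L μ G : ℝ} {σ : Fin N → ℝ} {sch : Scheme} {wstar : Param d}

/-- The coefficient of the `i`-th local update of device `k` in the aggregation of round `τ`:
the coefficient of the device if it performs this update, and `0` otherwise. -/
def weight (E : ℕ) (sch : Scheme) (τ : ℕ) (k : Fin N) (i : ℕ) (ω : Ω) : ℝ :=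
  if i < X.s τ ω k then sch.coef E X.p (X.s τ ω) k else 0

variable {X}

theorem weight_nonneg (hp : ∀ k, 0 < X.p k) (τ : ℕ) (k : Fin N) (i : ℕ) (ω : Ω) :
    0 ≤ X.weight E sch τ k i ω := by
  unfold weight
  split_ifs
  exacts [sch.coef_nonneg hp k, le_rfl]

theorem weight_le (hE : 0 < E) (hp : ∀ k, 0 < X.p k) (τ : ℕ) (k : Fin N) (i : ℕ) (ω : Ω) :
    X.weight E sch τ k i ω ≤ sch.theta N E * X.p k := by
  unfold weight
  split_ifs
  exacts [sch.coef_le hE hp k, (sch.coef_nonneg (v := X.s τ ω) hp k).trans (sch.coef_le hE hp k)]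

theorem sum_range_ite_lt {M : Type*} [AddCommMonoid M] {n m : ℕ} (h : n ≤ m) (f : ℕ → M) :
    ∑ i ∈ range m, (if i < n then f i else 0) = ∑ i ∈ range n, f i := by
  rw [← sum_filter]
  congr 1
  ext i
  simp only [mem_filter, mem_range]
  omega

theorem sum_weight (hs : ∀ τ ω k, X.s τ ω k ≤ E) (τ : ℕ) (k : Fin N) (ω : Ω) :
    ∑ i ∈ range E, X.weight E sch τ k i ω
      = sch.coef E X.p (X.s τ ω) k * (X.s τ ω k : ℝ) := by
  unfold weight
  rw [sum_range_ite_lt (hs τ ω k) (fun _ => sch.coef E X.p (X.s τ ω) k)]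
  simp [mul_comm]

theorem localIter_eq_sub_sum (η : ℝ) (k : Fin N) (w : Param d) (b : ℕ → Ξ) (n : ℕ) :
    X.localIter η k w b n =
      w - η • ∑ i ∈ range n, X.sgrad k (X.localIter η k w b i) (b i) := by
  induction n with
  | zero => simp [localIter]
  | succ n ih =>
    rw [sum_range_succ, smul_add, ← sub_sub, ← ih]
    rfl

theorem localW_eq {i : ℕ} (hi : i < E) (τ : ℕ) (k : Fin N) (ω : Ω) :
    X.localW E L μ sch (τ * E + i) k ω =
      X.localIter (X.rate E L μ sch τ) k (X.globalW E L μ sch τ ω)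
        (fun j => X.batch k (τ * E + j) ω) i := by
  have h1 : (τ * E + i) / E = τ := by
    rw [mul_comm, Nat.mul_add_div (by omega), Nat.div_eq_of_lt hi, add_zero]
  have h2 : (τ * E + i) % E = i := by
    rw [mul_comm, Nat.mul_add_mod, Nat.mod_eq_of_lt hi]
  simp only [localW, h1, h2]

theorem stochGrad_eq {i : ℕ} (hi : i < E) (τ : ℕ) (k : Fin N) (ω : Ω) :
    X.stochGrad E L μ sch (τ * E + i) k ω =
      X.sgrad k (X.localIter (X.rate E L μ sch τ) k (X.globalW E L μ sch τ ω)
        (fun j => X.batch k (τ * E + j) ω) i) (X.batch k (τ * E + i) ω) := by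
  rw [stochGrad, localW_eq hi]

theorem localW_eq_sub_sum {i : ℕ} (hi : i < E) (τ : ℕ) (k : Fin N) (ω : Ω) :
    X.localW E L μ sch (τ * E + i) k ω = X.globalW E L μ sch τ ω -
      X.rate E L μ sch τ • ∑ j ∈ range i, X.stochGrad E L μ sch (τ * E + j) k ω := by
  rw [localW_eq hi, localIter_eq_sub_sum]
  congr 2
  refine sum_congr rfl fun j hj => ?_
  rw [stochGrad_eq ((mem_range.1 hj).trans hi)]

/-- Local increments telescope. Putting the random number of updates into the weights makes the
index set deterministic, so that expectations can be taken term by term. -/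
theorem globalW_succ (hs : ∀ τ ω k, X.s τ ω k ≤ E) (τ : ℕ) (ω : Ω) :
    X.globalW E L μ sch (τ + 1) ω = X.globalW E L μ sch τ ω -
      X.rate E L μ sch τ • ∑ k, ∑ i ∈ range E,
        X.weight E sch τ k i ω • X.stochGrad E L μ sch (τ * E + i) k ω := by
  rw [globalW, sub_eq_add_neg, smul_sum, ← sum_neg_distrib]
  congr 1
  refine sum_congr rfl fun k _ => ?_
  rw [localIter_eq_sub_sum, sub_sub_cancel_left, smul_neg, smul_comm]
  congr 2
  rw [smul_sum]
  have : ∀ i, X.weight E sch τ k i ω • X.stochGrad E L μ sch (τ * E + i) k ω =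
      if i < X.s τ ω k then
        sch.coef E X.p (X.s τ ω) k • X.stochGrad E L μ sch (τ * E + i) k ω else 0 := by
    intro i
    unfold weight
    split_ifs <;> simp
  simp_rw [this]
  rw [sum_range_ite_lt (hs τ ω k)]
  refine sum_congr rfl fun i hi => ?_
  rw [stochGrad_eq ((mem_range.1 hi).trans_le (hs τ ω k))]

/-! ### Measurability along the run -/

end Run

section Measurability

variable {N d : ℕ} {Ω Ξ : Type*} {m mΩ : MeasurableSpace Ω} [MeasurableSpace Ξ]
  {X : System N d Ω Ξ} {E : ℕ} {L μ : ℝ} {sch : Scheme}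

/-- Here and in the next lemmas `m` is an arbitrary σ-algebra on the sample space. Taking for `m`
the one generated by the past yields independence of the run from fresh randomness. -/
theorem measurable_localIter (hg : ∀ k, Measurable (Function.uncurry (X.sgrad k)))
    (η : ℝ) (k : Fin N) {w : Ω → Param d} {b : ℕ → Ω → Ξ}
    (hw : Measurable[m] w) (n : ℕ) (hb : ∀ i < n, Measurable[m] (b i)) :
    Measurable[m] (fun ω => X.localIter η k (w ω) (fun i => b i ω) n) := by
  induction n with
  | zero => exact hw
  | succ n ih =>
    have h1 := ih fun i hi => hb i (hi.trans n.lt_succ_self)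
    have h2 : Measurable[m] (fun ω =>
        X.sgrad k (X.localIter η k (w ω) (fun i => b i ω) n) (b n ω)) :=
      (hg k).comp (h1.prodMk (hb n n.lt_succ_self))
    exact h1.sub (h2.const_smul η)

theorem measurable_weight {τ : ℕ} (hs : Measurable[m] (X.s τ))
    (k : Fin N) (i : ℕ) : Measurable[m] (X.weight E sch τ k i) := by
  have : X.weight E sch τ k i =
      (fun v : Fin N → ℕ => if i < v k then sch.coef E X.p v k else 0) ∘ X.s τ := rfl
  rw [this]
  exact (Measurable.of_discrete).comp hs

theorem measurable_globalW (hg : ∀ k, Measurable (Function.uncurry (X.sgrad k)))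
    (hsE : ∀ τ ω k, X.s τ ω k ≤ E) (h0 : Measurable[m] X.w0) (τ : ℕ)
    (hs : ∀ t < τ, Measurable[m] (X.s t)) (hb : ∀ k, ∀ t < τ * E, Measurable[m] (X.batch k t)) :
    Measurable[m] (X.globalW E L μ sch τ) := by
  induction τ with
  | zero => exact h0
  | succ τ ih =>
    have h1 := ih (fun t ht => hs t (ht.trans τ.lt_succ_self))
      (fun k t ht => hb k t (ht.trans_le (Nat.mul_le_mul_right E τ.le_succ)))
    have h2 : X.globalW E L μ sch (τ + 1) = fun ω => X.globalW E L μ sch τ ω -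
        X.rate E L μ sch τ • ∑ k, ∑ i ∈ range E,
          X.weight E sch τ k i ω • X.stochGrad E L μ sch (τ * E + i) k ω :=
      funext fun ω => globalW_succ hsE τ ω
    rw [h2]
    refine h1.sub (Measurable.fun_const_smul (Finset.measurable_fun_sum _ fun k _ =>
      Finset.measurable_fun_sum _ fun i hi => ?_) _)
    have hi' := mem_range.1 hi
    refine (measurable_weight (hs τ τ.lt_succ_self) k i).smul ?_
    have hb' : ∀ j ≤ i, Measurable[m] (X.batch k (τ * E + j)) := by
      intro j hj
      refine hb k _ ?_
      rw [Nat.succ_mul]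
      omega
    have h3 : X.stochGrad E L μ sch (τ * E + i) k = fun ω =>
        X.sgrad k (X.localIter (X.rate E L μ sch τ) k (X.globalW E L μ sch τ ω)
          (fun j => X.batch k (τ * E + j) ω) i) (X.batch k (τ * E + i) ω) :=
      funext fun ω => stochGrad_eq hi' τ k ω
    rw [h3]
    exact (hg k).comp ((measurable_localIter hg _ k h1 i fun j hj => hb' j hj.le).prodMk
      (hb' i le_rfl))

theorem measurable_localW (hg : ∀ k, Measurable (Function.uncurry (X.sgrad k)))
    (hsE : ∀ τ ω k, X.s τ ω k ≤ E) (h0 : Measurable[m] X.w0) (τ : ℕ)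
    (hs : ∀ t < τ, Measurable[m] (X.s t)) {i : ℕ} (hi : i < E)
    (hb : ∀ k, ∀ t < τ * E + i, Measurable[m] (X.batch k t)) (k : Fin N) :
    Measurable[m] (X.localW E L μ sch (τ * E + i) k) := by
  have h : X.localW E L μ sch (τ * E + i) k = fun ω =>
      X.localIter (X.rate E L μ sch τ) k (X.globalW E L μ sch τ ω)
        (fun j => X.batch k (τ * E + j) ω) i := funext fun ω => localW_eq hi τ k ω
  rw [h]
  exact measurable_localIter hg _ k
    (measurable_globalW hg hsE h0 τ hs fun k t ht => hb k t (ht.trans_le (Nat.le_add_right _ _)))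
    i fun j hj => hb k _ (by omega)

end Measurability

/-! ### Independence along the run -/

namespace Standing

variable {N d : ℕ} {Ω Ξ : Type*} [MeasurableSpace Ω] [MeasurableSpace Ξ]
  {X : System N d Ω Ξ} {E : ℕ} {L μ G : ℝ} {σ : Fin N → ℝ} {sch : Scheme} {wstar : Param d}

variable (h : X.Standing E L μ G σ sch wstar)
include h

theorem measurable_w (τ : ℕ) : Measurable (X.globalW E L μ sch τ) :=
  measurable_globalW h.meas_sgrad h.s_le h.meas_w0 τ (fun t _ => h.meas_s t)
    fun k t _ => h.meas_batch k t

theorem measurable_lw (τ : ℕ) {i : ℕ} (hi : i < E) (k : Fin N) :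
    Measurable (X.localW E L μ sch (τ * E + i) k) :=
  measurable_localW h.meas_sgrad h.s_le h.meas_w0 τ (fun t _ => h.meas_s t) hi
    (fun k t _ => h.meas_batch k t) k

theorem measurable_stochGrad (τ : ℕ) {i : ℕ} (hi : i < E) (k : Fin N) :
    Measurable (X.stochGrad E L μ sch (τ * E + i) k) :=
  (h.meas_sgrad k).comp ((h.measurable_lw τ hi k).prodMk (h.meas_batch k _))

/-- The participation vector of round `τ` is independent of the global weight at the beginning of
the round and of the stochastic gradients of the round. -/
theorem indepFun_s (τ : ℕ) {i : ℕ} (hi : i < E) (k : Fin N) :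
    IndepFun (X.s τ) (fun ω => (X.stochGrad E L μ sch (τ * E + i) k ω,
      X.globalW E L μ sch τ ω)) X.P := by
  have := h.prob
  have hS : Measurable fun ω (j : range τ) => X.s j ω :=
    measurable_pi_lambda _ fun j => h.meas_s j
  have hB : Measurable fun ω (kt : Fin N × ℕ) => X.batch kt.1 kt.2 ω :=
    measurable_pi_lambda _ fun kt => h.meas_batch kt.1 kt.2
  -- The blocks are adjoined in turn: earlier participation, all mini-batches, initial weight. The
  -- weights and gradients of the round are functions of these three.
  have h1 : IndepFun (X.s τ) (fun ω (j : range τ) => X.s j ω) X.P := by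
    have := h.indep_s.indepFun_finset {τ} (range τ) (by simp) h.meas_s
    exact this.comp (φ := fun v : ({τ} : Finset ℕ) → Fin N → ℕ => v ⟨τ, by simp⟩)
      (measurable_pi_apply _) measurable_id
  have h2 : IndepFun (X.s τ) (fun ω => ((fun j : range τ => X.s j ω),
      fun kt : Fin N × ℕ => X.batch kt.1 kt.2 ω)) X.P := by
    refine h1.prodMk_right_of_prodMk_left (h.meas_s τ) hS hB ?_
    exact h.indep_s_batch.comp
      (φ := fun u : ℕ → Fin N → ℕ => (u τ, fun j : range τ => u j)) (by fun_prop) measurable_id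
  have h3 : IndepFun (X.s τ) (fun ω => (((fun j : range τ => X.s j ω),
      fun kt : Fin N × ℕ => X.batch kt.1 kt.2 ω), X.w0 ω)) X.P := by
    refine h2.prodMk_right_of_prodMk_left (h.meas_s τ) (hS.prodMk hB) h.meas_w0 ?_
    exact h.indep_w0.symm.comp (φ := fun z : (ℕ → Fin N → ℕ) × (Fin N × ℕ → Ξ) =>
      (z.1 τ, ((fun j : range τ => z.1 j), z.2))) (by fun_prop) measurable_id
  refine h3.of_measurable_comap_right ?_
  set g : Ω → ((range τ → Fin N → ℕ) × (Fin N × ℕ → Ξ)) × Param d := fun ω =>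
    (((fun j : range τ => X.s j ω), fun kt : Fin N × ℕ => X.batch kt.1 kt.2 ω), X.w0 ω) with hg
  have hgm : Measurable[MeasurableSpace.comap g inferInstance] g := comap_measurable g
  have hw0 : Measurable[MeasurableSpace.comap g inferInstance] X.w0 := measurable_snd.comp hgm
  have hs : ∀ t < τ, Measurable[MeasurableSpace.comap g inferInstance] (X.s t) := fun t ht =>
    ((measurable_pi_apply (⟨t, mem_range.2 ht⟩ : range τ)).comp measurable_fst.fst).comp hgm
  have hb : ∀ k t, Measurable[MeasurableSpace.comap g inferInstance] (X.batch k t) := fun k t =>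
    ((measurable_pi_apply (k, t)).comp measurable_fst.snd).comp hgm
  have hl := measurable_localW (L := L) (μ := μ) (sch := sch) h.meas_sgrad h.s_le hw0 τ hs hi
    (fun k t _ => hb k t) k
  exact ((h.meas_sgrad k).comp (hl.prodMk (hb k _))).prodMk
    (measurable_globalW h.meas_sgrad h.s_le hw0 τ hs fun k t _ => hb k t)

/-- The mini-batch of a time step is independent of the current local weight and of the global
weight at the beginning of the round. -/
theorem indepFun_batch (τ : ℕ) {i : ℕ} (hi : i < E) (k : Fin N) :
    IndepFun (X.batch k (τ * E + i)) (fun ω => (X.localW E L μ sch (τ * E + i) k ω,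
      X.globalW E L μ sch τ ω)) X.P := by
  have := h.prob
  -- Strictly earlier mini-batches, of all devices, suffice: the current local weight does not see
  -- those of the present time step.
  set T : Finset (Fin N × ℕ) := univ ×ˢ range (τ * E + i) with hT
  have hU : Measurable fun ω (t : ℕ) => X.s t ω := measurable_pi_lambda _ fun j => h.meas_s j
  have hB : Measurable fun ω (kt : T) => X.batch kt.1.1 kt.1.2 ω :=
    measurable_pi_lambda _ fun kt => h.meas_batch _ _
  have h1 : IndepFun (X.batch k (τ * E + i)) (fun ω (kt : T) => X.batch kt.1.1 kt.1.2 ω) X.P := by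
    have := h.indep_batch.indepFun_finset {(k, τ * E + i)} T (by simp [hT])
      fun kt => h.meas_batch kt.1 kt.2
    exact this.comp
      (φ := fun v : ({(k, τ * E + i)} : Finset (Fin N × ℕ)) → Ξ => v ⟨(k, τ * E + i), by simp⟩)
      (measurable_pi_apply _) measurable_id
  have h2 : IndepFun (X.batch k (τ * E + i)) (fun ω => ((fun kt : T => X.batch kt.1.1 kt.1.2 ω),
      fun t : ℕ => X.s t ω)) X.P := by
    refine h1.prodMk_right_of_prodMk_left (h.meas_batch _ _) hB hU ?_
    exact h.indep_s_batch.symm.comp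
      (φ := fun b : Fin N × ℕ → Ξ => (b (k, τ * E + i), fun kt : T => b kt)) (by fun_prop)
      measurable_id
  have h3 : IndepFun (X.batch k (τ * E + i)) (fun ω => (((fun kt : T => X.batch kt.1.1 kt.1.2 ω),
      fun t : ℕ => X.s t ω), X.w0 ω)) X.P := by
    refine h2.prodMk_right_of_prodMk_left (h.meas_batch _ _) (hB.prodMk hU) h.meas_w0 ?_
    exact h.indep_w0.symm.comp (φ := fun z : (ℕ → Fin N → ℕ) × (Fin N × ℕ → Ξ) =>
      (z.2 (k, τ * E + i), ((fun kt : T => z.2 kt), z.1))) (by fun_prop) measurable_id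
  refine h3.of_measurable_comap_right ?_
  set g : Ω → ((T → Ξ) × (ℕ → Fin N → ℕ)) × Param d := fun ω =>
    (((fun kt : T => X.batch kt.1.1 kt.1.2 ω), fun t : ℕ => X.s t ω), X.w0 ω) with hg
  have hgm : Measurable[MeasurableSpace.comap g inferInstance] g := comap_measurable g
  have hw0 : Measurable[MeasurableSpace.comap g inferInstance] X.w0 := measurable_snd.comp hgm
  have hs : ∀ t, Measurable[MeasurableSpace.comap g inferInstance] (X.s t) := fun t =>
    ((measurable_pi_apply t).comp measurable_fst.snd).comp hgm
  have hb : ∀ k, ∀ t < τ * E + i,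
      Measurable[MeasurableSpace.comap g inferInstance] (X.batch k t) := fun k t ht =>
    ((measurable_pi_apply (⟨(k, t), by simp [hT, ht]⟩ : T)).comp measurable_fst.fst).comp hgm
  exact (measurable_localW h.meas_sgrad h.s_le hw0 τ (fun t _ => hs t) hi hb k).prodMk
    (measurable_globalW h.meas_sgrad h.s_le hw0 τ (fun t _ => hs t)
      fun k t ht => hb k t (ht.trans_le (Nat.le_add_right _ _)))

end Standing

end System

end FedAvg

/-! ### Square-integrable vectors and a weighted Cauchy-Schwarz inequality -/

theorem MeasureTheory.MemLp.integrable_inner_of_two {Ω V : Type*} {mΩ : MeasurableSpace Ω}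
    [NormedAddCommGroup V] [InnerProductSpace ℝ V] {P : Measure Ω} {f g : Ω → V}
    (hf : MemLp f 2 P) (hg : MemLp g 2 P) : Integrable (fun ω => (inner ℝ (f ω) (g ω) : ℝ)) P := by
  refine Integrable.mono' (((memLp_two_iff_integrable_sq_norm hf.1).1 hf).add
    ((memLp_two_iff_integrable_sq_norm hg.1).1 hg)) (hf.1.inner hg.1)
    (Filter.Eventually.of_forall fun ω => ?_)
  simp only [Pi.add_apply, Real.norm_eq_abs]
  refine (abs_real_inner_le_norm _ _).trans ?_
  nlinarith [sq_nonneg (‖f ω‖ - ‖g ω‖), sq_nonneg ‖f ω‖, sq_nonneg ‖g ω‖]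

/-- Weighted Cauchy-Schwarz inequality for sums of vectors. -/
theorem norm_sum_smul_sq_le {ι V : Type*} [NormedAddCommGroup V] [NormedSpace ℝ V] (s : Finset ι)
    {a : ι → ℝ} (ha : ∀ i ∈ s, 0 ≤ a i) (v : ι → V) :
    ‖∑ i ∈ s, a i • v i‖ ^ 2 ≤ (∑ i ∈ s, a i) * ∑ i ∈ s, a i * ‖v i‖ ^ 2 := by
  have h1 : ‖∑ i ∈ s, a i • v i‖ ≤ ∑ i ∈ s, a i * ‖v i‖ := by
    refine (norm_sum_le _ _).trans (sum_le_sum fun i hi => ?_)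
    rw [norm_smul, Real.norm_of_nonneg (ha i hi)]
  refine (pow_le_pow_left₀ (norm_nonneg _) h1 2).trans ?_
  refine sum_sq_le_sum_mul_sum_of_sq_le_mul s ha
    (fun i hi => mul_nonneg (ha i hi) (sq_nonneg _)) fun i _ => le_of_eq (by ring)

namespace FedAvg

namespace System

/-! ### Size of the learning rate -/

section Rate

variable {N d : ℕ} {Ω Ξ : Type*} [MeasurableSpace Ω] [MeasurableSpace Ξ]
  {X : System N d Ω Ξ} {E : ℕ} {L μ : ℝ} {sch : Scheme}

theorem gam_pos (hE : 0 < E) (hN : 0 < N) (hm : 0 < X.totalWork E sch) :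
    0 < X.gam E L μ sch := by
  have hθ := sch.one_le_theta hN hE
  exact lt_of_lt_of_le (by positivity) (le_max_right _ _)

theorem rate_pos_of_totalWork_pos (hE : 0 < E) (hN : 0 < N) (hμ : 0 < μ)
    (hm : 0 < X.totalWork E sch) (τ : ℕ) : 0 < X.rate E L μ sch τ := by
  have h2 : 0 < X.gam E L μ sch := gam_pos hE hN hm
  unfold rate
  positivity

/-- This is what the first entry of the maximum defining γ is for. -/
theorem rate_mul_le (hE : 0 < E) (hN : 0 < N) (hμ : 0 < μ)
    (hm : 0 < X.totalWork E sch) (τ : ℕ) :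
    X.rate E L μ sch τ * (2 * (1 + sch.theta N E) * L) ≤ 1 := by
  have h2 : 0 < X.gam E L μ sch := gam_pos hE hN hm
  have hE' : (0 : ℝ) < E := by exact_mod_cast hE
  have h3 : 32 * E * (1 + sch.theta N E) * L / (μ * X.totalWork E sch) ≤
      (τ : ℝ) * E + X.gam E L μ sch :=
    (le_max_left _ _).trans (le_add_of_nonneg_left (by positivity))
  rw [div_le_iff₀ (by positivity)] at h3
  have h4 : X.rate E L μ sch τ = 16 * E / (((τ : ℝ) * E + X.gam E L μ sch) *
      (μ * X.totalWork E sch)) := by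
    unfold rate
    field_simp
  rw [h4, div_mul_eq_mul_div, div_le_one (by positivity)]
  linarith

end Rate

namespace Standing

variable {N d : ℕ} {Ω Ξ : Type*} [MeasurableSpace Ω] [MeasurableSpace Ξ]
  {X : System N d Ω Ξ} {E : ℕ} {L μ G : ℝ} {σ : Fin N → ℝ} {sch : Scheme} {wstar : Param d}
  (h : X.Standing E L μ G σ sch wstar)
include h

/-! ### Mean work and learning rate -/

theorem pos_N : 0 < N := by
  rcases Nat.eq_zero_or_pos N with rfl | hN
  · simpa using h.p_sum
  · exact hN

theorem integrable_comp_s (τ : ℕ) (f : (Fin N → ℕ) → ℝ) (C : ℝ)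
    (hf : ∀ ω, |f (X.s τ ω)| ≤ C) : Integrable (fun ω => f (X.s τ ω)) X.P := by
  have := h.prob
  have hm : Measurable fun ω => f (X.s τ ω) := (Measurable.of_discrete (f := f)).comp (h.meas_s τ)
  exact Integrable.of_bound hm.aestronglyMeasurable C (Filter.Eventually.of_forall hf)

theorem integrable_weight (hE : 0 < E) (τ : ℕ) (k : Fin N) (i : ℕ) :
    Integrable (X.weight E sch τ k i) X.P :=
  h.integrable_comp_s τ (fun v => if i < v k then sch.coef E X.p v k else 0)
    (sch.theta N E * X.p k) fun ω => by
      rw [abs_of_nonneg]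
      exacts [weight_le hE h.p_pos τ k i ω, weight_nonneg h.p_pos τ k i ω]

theorem integrable_work (hE : 0 < E) (τ : ℕ) (k : Fin N) :
    Integrable (fun ω => sch.coef E X.p (X.s τ ω) k * (X.s τ ω k : ℝ)) X.P := by
  simp_rw [← sum_weight h.s_le τ k]
  exact integrable_finsetSum _ fun i _ => h.integrable_weight hE τ k i

theorem sum_integral_weight (hE : 0 < E) (τ : ℕ) (k : Fin N) :
    ∑ i ∈ range E, ∫ ω, X.weight E sch τ k i ω ∂X.P = X.meanWork E sch τ k := by
  rw [← integral_finsetSum _ fun i _ => h.integrable_weight hE τ k i]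
  simp_rw [sum_weight h.s_le τ k]
  rfl

theorem integral_weight_nonneg (τ : ℕ) (k : Fin N) (i : ℕ) :
    0 ≤ ∫ ω, X.weight E sch τ k i ω ∂X.P :=
  integral_nonneg fun ω => weight_nonneg h.p_pos τ k i ω

theorem meanWork_nonneg (τ : ℕ) (k : Fin N) : 0 ≤ X.meanWork E sch τ k :=
  integral_nonneg fun _ => mul_nonneg (sch.coef_nonneg h.p_pos k) (Nat.cast_nonneg _)

theorem totalWork_eq (hE : 0 < E) : X.totalWork E sch = ∑ k, X.meanWork E sch 0 k := by
  unfold totalWork meanWork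
  rw [integral_finsetSum _ fun k _ => h.integrable_work hE 0 k]

theorem totalWork_pos (hE : 0 < E) : 0 < X.totalWork E sch := by
  refine lt_of_le_of_ne ?_ h.work_ne.symm
  rw [h.totalWork_eq hE]
  exact sum_nonneg fun k _ => h.meanWork_nonneg 0 k

theorem sum_weight_le (hE : 0 < E) (τ : ℕ) (ω : Ω) :
    ∑ k, ∑ i ∈ range E, X.weight E sch τ k i ω ≤ sch.theta N E * E := by
  calc ∑ k, ∑ i ∈ range E, X.weight E sch τ k i ω
      ≤ ∑ k, ∑ _i ∈ range E, sch.theta N E * X.p k :=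
        sum_le_sum fun k _ => sum_le_sum fun i _ => weight_le hE h.p_pos τ k i ω
    _ = sch.theta N E * E := by
        simp only [sum_const, card_range, nsmul_eq_mul]
        rw [← mul_sum, ← mul_sum, h.p_sum]; ring

theorem totalWork_le (hE : 0 < E) : X.totalWork E sch ≤ sch.theta N E * E := by
  have := h.prob
  unfold totalWork
  simp_rw [← sum_weight h.s_le 0]
  calc _ ≤ ∫ _, sch.theta N E * (E : ℝ) ∂X.P := by
        refine integral_mono ?_ (integrable_const _) fun ω => h.sum_weight_le hE 0 ω
        exact integrable_finsetSum _ fun k _ => integrable_finsetSum _ fun i _ =>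
          h.integrable_weight hE 0 k i
    _ = _ := by simp

/-- The second entry of the maximum is 4E · (θE / m), and m ≤ θE. It keeps the contraction factor 1
- 2E/(τE + γ) nonnegative. -/
theorem four_mul_le_gam (hE : 0 < E) : 4 * (E : ℝ) ≤ X.gam E L μ sch := by
  refine le_trans ?_ (le_max_right _ _)
  rw [le_div_iff₀ (h.totalWork_pos hE)]
  have := h.totalWork_le hE
  nlinarith [show (0 : ℝ) < E by exact_mod_cast hE]

theorem rate_pos (hE : 0 < E) (hμ : 0 < μ) (τ : ℕ) : 0 < X.rate E L μ sch τ :=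
  rate_pos_of_totalWork_pos hE h.pos_N hμ (h.totalWork_pos hE) τ

/-! ### Square integrability along the run -/

theorem memLp_stochGrad (τ : ℕ) {i : ℕ} (hi : i < E) (k : Fin N) :
    MemLp (X.stochGrad E L μ sch (τ * E + i) k) 2 X.P :=
  (memLp_two_iff_integrable_sq_norm (h.measurable_stochGrad τ hi k).aestronglyMeasurable).2
    (h.second_moment k _).1

theorem memLp_weight_smul (hE : 0 < E) (τ : ℕ) {i : ℕ} (hi : i < E) (k : Fin N) :
    MemLp (fun ω => X.weight E sch τ k i ω • X.stochGrad E L μ sch (τ * E + i) k ω) 2 X.P := by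
  refine (h.memLp_stochGrad τ hi k).of_le_mul (c := sch.theta N E * X.p k)
    ((measurable_weight (h.meas_s τ) k i).smul
      (h.measurable_stochGrad τ hi k)).aestronglyMeasurable
    (Filter.Eventually.of_forall fun ω => ?_)
  rw [norm_smul, Real.norm_of_nonneg (weight_nonneg h.p_pos τ k i ω)]
  exact mul_le_mul_of_nonneg_right (weight_le hE h.p_pos τ k i ω) (norm_nonneg _)

theorem memLp_sum (hE : 0 < E) (τ : ℕ) :
    MemLp (fun ω => ∑ k, ∑ i ∈ range E,
      X.weight E sch τ k i ω • X.stochGrad E L μ sch (τ * E + i) k ω) 2 X.P :=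
  memLp_finsetSum _ fun k _ => memLp_finsetSum _ fun _ hi =>
    h.memLp_weight_smul hE τ (mem_range.1 hi) k

theorem memLp_w (hE : 0 < E) (τ : ℕ) : MemLp (X.globalW E L μ sch τ) 2 X.P := by
  induction τ with
  | zero => exact h.memLp_w0
  | succ τ ih =>
    have h2 : X.globalW E L μ sch (τ + 1) = fun ω => X.globalW E L μ sch τ ω -
        X.rate E L μ sch τ • ∑ k, ∑ i ∈ range E,
          X.weight E sch τ k i ω • X.stochGrad E L μ sch (τ * E + i) k ω :=
      funext fun ω => globalW_succ h.s_le τ ω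
    rw [h2]
    exact ih.sub ((h.memLp_sum hE τ).const_smul (X.rate E L μ sch τ))

theorem memLp_w_sub (hE : 0 < E) (τ : ℕ) :
    MemLp (fun ω => X.globalW E L μ sch τ ω - wstar) 2 X.P :=
  have := h.prob
  (h.memLp_w hE τ).sub (memLp_const _)

theorem integrable_err (hE : 0 < E) (τ : ℕ) :
    Integrable (fun ω => ‖X.globalW E L μ sch τ ω - wstar‖ ^ 2) X.P :=
  (memLp_two_iff_integrable_sq_norm (h.memLp_w_sub hE τ).1).1 (h.memLp_w_sub hE τ)

theorem memLp_lw (hE : 0 < E) (τ : ℕ) {i : ℕ} (hi : i < E) (k : Fin N) :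
    MemLp (X.localW E L μ sch (τ * E + i) k) 2 X.P := by
  have h2 : X.localW E L μ sch (τ * E + i) k = fun ω => X.globalW E L μ sch τ ω -
      X.rate E L μ sch τ • ∑ j ∈ range i, X.stochGrad E L μ sch (τ * E + j) k ω :=
    funext fun ω => localW_eq_sub_sum hi τ k ω
  rw [h2]
  exact (h.memLp_w hE τ).sub ((memLp_finsetSum _ fun j hj =>
    h.memLp_stochGrad τ ((mem_range.1 hj).trans hi) k).const_smul (X.rate E L μ sch τ))

theorem continuous_gradient (hL : 0 < L) (k : Fin N) : Continuous (gradient (X.F k)) := by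
  have : LipschitzWith L.toNNReal (gradient (X.F k)) := LipschitzWith.of_dist_le_mul fun x y => by
    rw [dist_eq_norm, dist_eq_norm, Real.coe_toNNReal _ hL.le]
    exact h.smooth k x y
  exact this.continuous

/-- A Lipschitz gradient grows at most linearly, so it inherits square integrability from the local
weight. -/
theorem memLp_gradient (hE : 0 < E) (hL : 0 < L) (τ : ℕ) {i : ℕ} (hi : i < E) (k : Fin N) :
    MemLp (fun ω => gradient (X.F k) (X.localW E L μ sch (τ * E + i) k ω)) 2 X.P := by
  have := h.prob
  have h1 : MemLp (fun ω => gradient (X.F k) (X.localW E L μ sch (τ * E + i) k ω) -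
      gradient (X.F k) 0) 2 X.P := by
    refine (h.memLp_lw hE τ hi k).of_le_mul (c := L)
      (((h.continuous_gradient hL k).measurable.comp (h.measurable_lw τ hi k)).sub
        measurable_const).aestronglyMeasurable (Filter.Eventually.of_forall fun ω => ?_)
    simpa using h.smooth k (X.localW E L μ sch (τ * E + i) k ω) 0
  convert! h1.add (memLp_const (gradient (X.F k) 0)) using 1
  ext1 ω
  simp

/-! ### The recursion for the mean squared error -/

/-- The weight is a function of the participation vector alone, hence independent of the pair inside
`ψ`. -/
theorem integral_weight_mul (τ : ℕ) {i : ℕ} (hi : i < E) (k : Fin N)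
    {ψ : Param d × Param d → ℝ} (hψ : Measurable ψ) :
    ∫ ω, X.weight E sch τ k i ω *
        ψ (X.stochGrad E L μ sch (τ * E + i) k ω, X.globalW E L μ sch τ ω) ∂X.P =
      (∫ ω, X.weight E sch τ k i ω ∂X.P) *
        ∫ ω, ψ (X.stochGrad E L μ sch (τ * E + i) k ω, X.globalW E L μ sch τ ω) ∂X.P := by
  have hind := (h.indepFun_s τ hi k).comp
    (φ := fun v : Fin N → ℕ => if i < v k then sch.coef E X.p v k else 0)
    Measurable.of_discrete hψ
  exact hind.integral_fun_mul_eq_mul_integral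
    (measurable_weight (h.meas_s τ) k i).aestronglyMeasurable
    (hψ.comp ((h.measurable_stochGrad τ hi k).prodMk
      (h.measurable_w τ))).aestronglyMeasurable

theorem integral_inner_stochGrad (hE : 0 < E) (τ : ℕ) {i : ℕ} (hi : i < E)
    (k : Fin N) :
    ∫ ω, (inner ℝ (X.stochGrad E L μ sch (τ * E + i) k ω)
        (X.globalW E L μ sch τ ω - wstar) : ℝ) ∂X.P =
      ∫ ω, (inner ℝ (gradient (X.F k) (X.localW E L μ sch (τ * E + i) k ω))
        (X.globalW E L μ sch τ ω - wstar) : ℝ) ∂X.P := by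
  have := h.prob
  refine IndepFun.integral_inner_eq_of_mean (h.meas_batch k (τ * E + i)) (h.measurable_lw τ hi k)
    ((h.measurable_w τ).sub measurable_const) ?_ (h.meas_sgrad k)
    (fun w => h.unbiased k (τ * E + i) w) ?_
  · exact (h.indepFun_batch τ hi k).comp (ψ := fun z : Param d × Param d => (z.1, z.2 - wstar))
      measurable_id (by fun_prop)
  · exact (h.memLp_stochGrad τ hi k).integrable_inner_of_two (h.memLp_w_sub hE τ)

/-- Cauchy-Schwarz with the random weights as masses: one factor of total mass is bounded by θE
surely, the other is averaged and becomes m. Keeping this m, rather than a second θE, gives noise of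
order 1/m after insertion of η. -/
theorem integral_norm_sum_sq_le (hE : 0 < E) (τ : ℕ) :
    ∫ ω, ‖∑ k, ∑ i ∈ range E,
      X.weight E sch τ k i ω • X.stochGrad E L μ sch (τ * E + i) k ω‖ ^ 2 ∂X.P ≤
      sch.theta N E * E * (X.totalWork E sch * G ^ 2) := by
  have hθ := sch.one_le_theta h.pos_N hE
  have hint : ∀ k, ∀ i ∈ range E, Integrable (fun ω => X.weight E sch τ k i ω *
      ‖X.stochGrad E L μ sch (τ * E + i) k ω‖ ^ 2) X.P := by
    intro k i hi
    refine Integrable.bdd_mul (c := sch.theta N E * X.p k) (h.second_moment k _).1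
      (measurable_weight (h.meas_s τ) k i).aestronglyMeasurable
      (Filter.Eventually.of_forall fun ω => ?_)
    rw [Real.norm_of_nonneg (weight_nonneg h.p_pos τ k i ω)]
    exact weight_le hE h.p_pos τ k i ω
  have hint2 : Integrable (fun ω => ∑ k, ∑ i ∈ range E, X.weight E sch τ k i ω *
      ‖X.stochGrad E L μ sch (τ * E + i) k ω‖ ^ 2) X.P :=
    integrable_finsetSum _ fun k _ => integrable_finsetSum _ fun i hi => hint k i hi
  calc _ ≤ ∫ ω, sch.theta N E * E * ∑ k, ∑ i ∈ range E, X.weight E sch τ k i ω *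
        ‖X.stochGrad E L μ sch (τ * E + i) k ω‖ ^ 2 ∂X.P := by
        refine integral_mono ((memLp_two_iff_integrable_sq_norm (h.memLp_sum hE τ).1).1
          (h.memLp_sum hE τ)) (hint2.const_mul _) fun ω => ?_
        have h1 := norm_sum_smul_sq_le (univ ×ˢ range E)
          (a := fun q : Fin N × ℕ => X.weight E sch τ q.1 q.2 ω)
          (fun q _ => weight_nonneg h.p_pos τ q.1 q.2 ω)
          (fun q => X.stochGrad E L μ sch (τ * E + q.2) q.1 ω)
        simp only [sum_product] at h1
        refine h1.trans (mul_le_mul_of_nonneg_right (h.sum_weight_le hE τ ω) ?_)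
        exact sum_nonneg fun k _ => sum_nonneg fun i _ =>
          mul_nonneg (weight_nonneg h.p_pos τ k i ω) (sq_nonneg _)
    _ = sch.theta N E * E * ∑ k, ∑ i ∈ range E, (∫ ω, X.weight E sch τ k i ω ∂X.P) *
        ∫ ω, ‖X.stochGrad E L μ sch (τ * E + i) k ω‖ ^ 2 ∂X.P := by
        rw [integral_const_mul, integral_finsetSum _ fun k _ =>
          integrable_finsetSum _ fun i hi => hint k i hi]
        congr 1
        refine sum_congr rfl fun k _ => ?_
        rw [integral_finsetSum _ fun i hi => hint k i hi]
        refine sum_congr rfl fun i hi => ?_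
        exact h.integral_weight_mul τ (mem_range.1 hi) k (ψ := fun z => ‖z.1‖ ^ 2) (by fun_prop)
    _ ≤ sch.theta N E * E * ∑ k, ∑ i ∈ range E, (∫ ω, X.weight E sch τ k i ω ∂X.P) * G ^ 2 := by
        gcongr with k _ i _
        · exact h.integral_weight_nonneg τ k i
        · exact (h.second_moment k _).2
    _ = _ := by
        simp_rw [← sum_mul, h.sum_integral_weight hE]
        rw [h.totalWork_eq hE]
        congr 2
        exact sum_congr rfl fun k _ => h.static τ k

theorem integral_drift_sq_le (hE : 0 < E) (τ : ℕ) {i : ℕ} (hi : i < E) (k : Fin N) :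
    ∫ ω, ‖X.localW E L μ sch (τ * E + i) k ω - X.globalW E L μ sch τ ω‖ ^ 2 ∂X.P ≤
      X.rate E L μ sch τ ^ 2 * (E ^ 2 * G ^ 2) := by
  have hint : ∀ j ∈ range i,
      Integrable (fun ω => ‖X.stochGrad E L μ sch (τ * E + j) k ω‖ ^ 2) X.P :=
    fun j _ => (h.second_moment k _).1
  calc _ ≤ ∫ ω, X.rate E L μ sch τ ^ 2 * (E * ∑ j ∈ range i,
        ‖X.stochGrad E L μ sch (τ * E + j) k ω‖ ^ 2) ∂X.P := by
        refine integral_mono ((memLp_two_iff_integrable_sq_norm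
          ((h.memLp_lw hE τ hi k).sub (h.memLp_w hE τ)).1).1
          ((h.memLp_lw hE τ hi k).sub (h.memLp_w hE τ)))
          (((integrable_finsetSum _ hint).const_mul _).const_mul _) fun ω => ?_
        simp only [localW_eq_sub_sum hi, sub_sub_cancel_left, norm_neg, norm_smul, mul_pow,
          Real.norm_eq_abs, sq_abs]
        refine mul_le_mul_of_nonneg_left ?_ (sq_nonneg _)
        have h1 := norm_sum_smul_sq_le (range i) (a := fun _ => (1 : ℝ)) (by simp)
          (fun j => X.stochGrad E L μ sch (τ * E + j) k ω)
        simp only [one_smul, one_mul, sum_const, card_range, nsmul_eq_mul, mul_one] at h1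
        refine h1.trans (mul_le_mul_of_nonneg_right ?_ (sum_nonneg fun j _ => sq_nonneg _))
        exact_mod_cast hi.le
    _ = X.rate E L μ sch τ ^ 2 * (E * ∑ j ∈ range i,
        ∫ ω, ‖X.stochGrad E L μ sch (τ * E + j) k ω‖ ^ 2 ∂X.P) := by
        rw [integral_const_mul, integral_const_mul, integral_finsetSum _ hint]
    _ ≤ X.rate E L μ sch τ ^ 2 * (E * ∑ _j ∈ range i, G ^ 2) := by
        gcongr with j _
        exact (h.second_moment k _).2
    _ ≤ _ := by
        simp only [sum_const, card_range, nsmul_eq_mul]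
        rw [sq (E : ℝ), mul_assoc (E : ℝ)]
        have : (i : ℝ) ≤ E := by exact_mod_cast hi.le
        gcongr

/-- The expected inner product of the aggregated stochastic gradients of a round with the error. -/
theorem le_integral_inner_sum (hE : 0 < E) (hL : 0 < L) (hμ : 0 < μ) (τ : ℕ) {β : ℝ}
    (hβ : ∀ w, -β ≤ ∑ k, X.meanWork E sch 0 k * (X.F k w - X.F k wstar)) :
    -β + X.totalWork E sch * (μ / 4) * X.err E L μ sch wstar τ -
        L ^ 2 / μ * (X.totalWork E sch * (X.rate E L μ sch τ ^ 2 * (E ^ 2 * G ^ 2))) ≤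
      ∫ ω, (inner ℝ (∑ k, ∑ i ∈ range E,
        X.weight E sch τ k i ω • X.stochGrad E L μ sch (τ * E + i) k ω)
          (X.globalW E L μ sch τ ω - wstar) : ℝ) ∂X.P := by
  have := h.prob
  set α : Fin N → ℕ → ℝ := fun k i => ∫ ω, X.weight E sch τ k i ω ∂X.P with hα
  have hαsum : ∀ k, ∑ i ∈ range E, α k i = X.meanWork E sch 0 k := fun k => by
    rw [hα, h.sum_integral_weight hE, h.static]
  have hαtot : ∑ k, ∑ i ∈ range E, α k i = X.totalWork E sch := by
    simp_rw [hαsum, h.totalWork_eq hE]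
  have hα0 : ∀ k i, 0 ≤ α k i := fun k i => h.integral_weight_nonneg τ k i
  have hint : ∀ k, ∀ i ∈ range E, Integrable (fun ω => (inner ℝ (X.weight E sch τ k i ω •
      X.stochGrad E L μ sch (τ * E + i) k ω) (X.globalW E L μ sch τ ω - wstar) : ℝ)) X.P :=
    fun k i hi => (h.memLp_weight_smul hE τ (mem_range.1 hi) k).integrable_inner_of_two
      (h.memLp_w_sub hE τ)
  have hintg : ∀ k, ∀ i ∈ range E, Integrable (fun ω => α k i *
      (inner ℝ (gradient (X.F k) (X.localW E L μ sch (τ * E + i) k ω))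
        (X.globalW E L μ sch τ ω - wstar) : ℝ)) X.P :=
    fun k i hi => ((h.memLp_gradient hE hL τ (mem_range.1 hi) k).integrable_inner_of_two
      (h.memLp_w_sub hE τ)).const_mul _
  have hintd : ∀ k, ∀ i ∈ range E, Integrable (fun ω => α k i *
      ‖X.localW E L μ sch (τ * E + i) k ω - X.globalW E L μ sch τ ω‖ ^ 2) X.P :=
    fun k i hi => ((memLp_two_iff_integrable_sq_norm
      ((h.memLp_lw hE τ (mem_range.1 hi) k).sub (h.memLp_w hE τ)).1).1
      ((h.memLp_lw hE τ (mem_range.1 hi) k).sub (h.memLp_w hE τ))).const_mul _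
  -- Independence replaces the weights by their means `α k i`, and unbiasedness replaces stochastic
  -- by full gradients.
  have e1 : ∫ ω, (inner ℝ (∑ k, ∑ i ∈ range E,
        X.weight E sch τ k i ω • X.stochGrad E L μ sch (τ * E + i) k ω)
          (X.globalW E L μ sch τ ω - wstar) : ℝ) ∂X.P =
      ∫ ω, ∑ k, ∑ i ∈ range E, α k i *
        (inner ℝ (gradient (X.F k) (X.localW E L μ sch (τ * E + i) k ω))
        (X.globalW E L μ sch τ ω - wstar) : ℝ) ∂X.P := by
    simp_rw [sum_inner]
    rw [integral_finsetSum _ fun k _ => integrable_finsetSum _ fun i hi => hint k i hi,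
      integral_finsetSum _ fun k _ => integrable_finsetSum _ fun i hi => hintg k i hi]
    refine sum_congr rfl fun k _ => ?_
    rw [integral_finsetSum _ fun i hi => hint k i hi, integral_finsetSum _ fun i hi => hintg k i hi]
    refine sum_congr rfl fun i hi => ?_
    rw [integral_const_mul, ← h.integral_inner_stochGrad hE τ (mem_range.1 hi) k]
    simp_rw [real_inner_smul_left]
    exact h.integral_weight_mul τ (mem_range.1 hi) k
      (ψ := fun z => (inner ℝ z.1 (z.2 - wstar) : ℝ)) (by fun_prop)
  -- Since the `α k i` are constants, strong convexity applies pointwise, and summing over i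
  -- recovers the mean work to which `hβ` refers.
  have e2 : ∀ ω, -β + X.totalWork E sch * (μ / 4) * ‖X.globalW E L μ sch τ ω - wstar‖ ^ 2 -
      L ^ 2 / μ * ∑ k, ∑ i ∈ range E, α k i *
        ‖X.localW E L μ sch (τ * E + i) k ω - X.globalW E L μ sch τ ω‖ ^ 2 ≤
      ∑ k, ∑ i ∈ range E, α k i *
        (inner ℝ (gradient (X.F k) (X.localW E L μ sch (τ * E + i) k ω))
        (X.globalW E L μ sch τ ω - wstar) : ℝ) := by
    intro ω
    set w := X.globalW E L μ sch τ ω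
    have h1 : ∑ k, ∑ i ∈ range E, α k i * (X.F k w - X.F k wstar + μ / 4 * ‖w - wstar‖ ^ 2 -
        L ^ 2 / μ * ‖X.localW E L μ sch (τ * E + i) k ω - w‖ ^ 2) ≤
        ∑ k, ∑ i ∈ range E, α k i *
        (inner ℝ (gradient (X.F k) (X.localW E L μ sch (τ * E + i) k ω)) (w - wstar) : ℝ) :=
      sum_le_sum fun k _ => sum_le_sum fun i _ => mul_le_mul_of_nonneg_left
        ((h.strong k).le_inner_gradient_of_lipschitz hμ (h.diff k) (h.smooth k) _ _ _) (hα0 k i)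
    refine le_trans ?_ h1
    have h2 : ∑ k, ∑ i ∈ range E, α k i * (X.F k w - X.F k wstar + μ / 4 * ‖w - wstar‖ ^ 2 -
        L ^ 2 / μ * ‖X.localW E L μ sch (τ * E + i) k ω - w‖ ^ 2) =
        ∑ k, X.meanWork E sch 0 k * (X.F k w - X.F k wstar) +
        X.totalWork E sch * (μ / 4) * ‖w - wstar‖ ^ 2 - L ^ 2 / μ * ∑ k, ∑ i ∈ range E, α k i *
          ‖X.localW E L μ sch (τ * E + i) k ω - w‖ ^ 2 := by
      rw [← hαtot]
      simp_rw [← hαsum, mul_sum, sum_mul, ← sum_add_distrib, ← sum_sub_distrib]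
      refine sum_congr rfl fun k _ => ?_
      exact sum_congr rfl fun i _ => by ring
    rw [h2]
    linarith [hβ w]
  have hintd' : Integrable (fun ω => ∑ k, ∑ i ∈ range E, α k i *
        ‖X.localW E L μ sch (τ * E + i) k ω - X.globalW E L μ sch τ ω‖ ^ 2) X.P :=
    integrable_finsetSum _ fun k _ => integrable_finsetSum _ fun i hi => hintd k i hi
  have hi1 : Integrable (fun ω => -β + X.totalWork E sch * (μ / 4) *
      ‖X.globalW E L μ sch τ ω - wstar‖ ^ 2) X.P :=
    (integrable_const _).add ((h.integrable_err hE τ).const_mul _)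
  have hi2 : Integrable (fun ω => -β + X.totalWork E sch * (μ / 4) *
      ‖X.globalW E L μ sch τ ω - wstar‖ ^ 2 - L ^ 2 / μ * ∑ k, ∑ i ∈ range E, α k i *
        ‖X.localW E L μ sch (τ * E + i) k ω - X.globalW E L μ sch τ ω‖ ^ 2) X.P :=
    hi1.sub (hintd'.const_mul (L ^ 2 / μ))
  have e3 := integral_mono hi2
    (integrable_finsetSum _ fun k _ => integrable_finsetSum _ fun i hi => hintg k i hi) e2
  rw [e1]
  refine le_trans ?_ e3
  rw [integral_sub hi1 (hintd'.const_mul _),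
    integral_add (integrable_const _) ((h.integrable_err hE τ).const_mul _), integral_const_mul,
    integral_const_mul, integral_const]
  have e4 : ∫ ω, ∑ k, ∑ i ∈ range E, α k i *
        ‖X.localW E L μ sch (τ * E + i) k ω - X.globalW E L μ sch τ ω‖ ^ 2 ∂X.P ≤
      X.totalWork E sch * (X.rate E L μ sch τ ^ 2 * (E ^ 2 * G ^ 2)) := by
    rw [integral_finsetSum _ fun k _ => integrable_finsetSum _ fun i hi => hintd k i hi, ← hαtot,
      sum_mul]
    refine sum_le_sum fun k _ => ?_
    rw [integral_finsetSum _ fun i hi => hintd k i hi, sum_mul]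
    refine sum_le_sum fun i hi => ?_
    rw [integral_const_mul]
    exact mul_le_mul_of_nonneg_left (h.integral_drift_sq_le hE τ (mem_range.1 hi) k) (hα0 k i)
  have e5 := mul_le_mul_of_nonneg_left e4 (show 0 ≤ L ^ 2 / μ by positivity)
  simp only [probReal_univ, smul_eq_mul, one_mul]
  exact sub_le_sub_left e5 _

/-- The one-round recursion for the mean squared error. -/
theorem err_succ_le (hE : 0 < E) (hL : 0 < L) (hμ : 0 < μ) (τ : ℕ) {β : ℝ}
    (hβ : ∀ w, -β ≤ ∑ k, X.meanWork E sch 0 k * (X.F k w - X.F k wstar)) :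
    X.err E L μ sch wstar (τ + 1) ≤
      X.err E L μ sch wstar τ - 2 * X.rate E L μ sch τ *
        (-β + X.totalWork E sch * (μ / 4) * X.err E L μ sch wstar τ -
        L ^ 2 / μ * (X.totalWork E sch * (X.rate E L μ sch τ ^ 2 * (E ^ 2 * G ^ 2)))) +
      X.rate E L μ sch τ ^ 2 * (sch.theta N E * E * (X.totalWork E sch * G ^ 2)) := by
  have hη := (h.rate_pos hE hμ τ).le
  set η := X.rate E L μ sch τ
  have hS := h.memLp_sum hE τ
  have hS2 := (memLp_two_iff_integrable_sq_norm hS.1).1 hS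
  have hI := hS.integrable_inner_of_two (h.memLp_w_sub hE τ)
  have hI2 : Integrable (fun ω => ‖X.globalW E L μ sch τ ω - wstar‖ ^ 2 - 2 * η *
      (inner ℝ (∑ k, ∑ i ∈ range E,
        X.weight E sch τ k i ω • X.stochGrad E L μ sch (τ * E + i) k ω)
          (X.globalW E L μ sch τ ω - wstar) : ℝ)) X.P :=
    (h.integrable_err hE τ).sub (hI.const_mul _)
  have e1 : X.err E L μ sch wstar (τ + 1) = X.err E L μ sch wstar τ - 2 * η *
      (∫ ω, (inner ℝ (∑ k, ∑ i ∈ range E,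
        X.weight E sch τ k i ω • X.stochGrad E L μ sch (τ * E + i) k ω)
          (X.globalW E L μ sch τ ω - wstar) : ℝ) ∂X.P) + η ^ 2 * ∫ ω, ‖∑ k, ∑ i ∈ range E,
      X.weight E sch τ k i ω • X.stochGrad E L μ sch (τ * E + i) k ω‖ ^ 2 ∂X.P := by
    unfold err
    rw [← integral_const_mul, ← integral_const_mul,
      ← integral_sub (h.integrable_err hE τ) (hI.const_mul _),
      ← integral_add hI2 (hS2.const_mul _)]
    refine integral_congr_ae (Filter.Eventually.of_forall fun ω => ?_)
    simp only [globalW_succ h.s_le]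
    rw [sub_right_comm, norm_sub_sq_real, norm_smul, real_inner_smul_right, mul_pow,
      Real.norm_eq_abs, sq_abs, real_inner_comm]
    ring
  rw [e1]
  have e2 := mul_le_mul_of_nonneg_left (h.le_integral_inner_sum hE hL hμ τ hβ)
    (show 0 ≤ 2 * η by positivity)
  have e3 := mul_le_mul_of_nonneg_left (h.integral_norm_sum_sq_le hE τ) (sq_nonneg η)
  linarith

end Standing

end System

end FedAvg

/-! ### Solving the recursion -/

/-- Solution of the recursion of stochastic approximation with step sizes `1 / (n a + γ)`. -/
theorem le_div_of_recursion {a γ A D : ℝ} {u r : ℕ → ℝ} (ha : 0 < a) (hγ : 2 * a ≤ γ) (hD : 0 ≤ D)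
    (hA : 0 ≤ A) (hr : ∀ n, 0 ≤ r n) (hu0 : 0 ≤ u 0)
    (hrec : ∀ n, u (n + 1) ≤ (1 - 2 * a / (n * a + γ)) * u n + D / 2 * r n / (n * a + γ)
      + A / (n * a + γ) ^ 2) (n : ℕ) :
    u n ≤ ((∑ t ∈ range n, r t) * D + (γ * u 0 + A / a)) / (n * a + γ) := by
  induction n with
  | zero =>
    have hγ0 : 0 < γ := by linarith
    simp only [range_zero, sum_empty, zero_mul, zero_add, Nat.cast_zero]
    rw [le_div_iff₀ hγ0]
    have : 0 ≤ A / a := by positivity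
    linarith
  | succ n ih =>
    set x : ℝ := n * a + γ with hx
    have hx2 : 2 * a ≤ x := le_add_of_nonneg_of_le (by positivity) hγ
    have hx0 : 0 < x := by linarith
    have hx' : ((n + 1 : ℕ) : ℝ) * a + γ = x + a := by push_cast; ring
    rw [hx', sum_range_succ]
    set R := ∑ t ∈ range n, r t
    set V := γ * u 0 + A / a
    have hR : 0 ≤ R := sum_nonneg fun t _ => hr t
    have hV : A / a ≤ V := le_add_of_nonneg_left (mul_nonneg (by linarith) hu0)
    have hVA : A ≤ V * a := by rwa [div_le_iff₀ ha] at hV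
    have hc : 0 ≤ 1 - 2 * a / x := by rw [sub_nonneg, div_le_one hx0]; exact hx2
    refine (hrec n).trans ?_
    have h1 := mul_le_mul_of_nonneg_left ih hc
    -- (x - 2a)(x + a) = x² - ax - 2a²: the contraction 2a is twice what the growing denominator
    -- costs, and the surplus pays for the noise because A ≤ Va.
    have h2 : (1 - 2 * a / x) * ((R * D + V) / x) + A / x ^ 2 ≤ (R * D + V) / (x + a) := by
      have e : (1 - 2 * a / x) * ((R * D + V) / x) + A / x ^ 2 =
          ((x - 2 * a) * (R * D + V) + A) / x ^ 2 := by field_simp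
      rw [e, div_le_div_iff₀ (by positivity) (by positivity)]
      have hRD : 0 ≤ R * D := mul_nonneg hR hD
      have hV0 : 0 ≤ V := le_trans (by positivity) hV
      have h3 : A * (x + a) ≤ V * a * (x + a) := mul_le_mul_of_nonneg_right hVA (by positivity)
      nlinarith [mul_nonneg hRD (by positivity : 0 ≤ a * x + 2 * a ^ 2),
        mul_nonneg hV0 (by positivity : 0 ≤ a ^ 2)]
    -- The half in front of D compensates x + a ≤ 2x.
    have h4 : D / 2 * r n / x ≤ r n * D / (x + a) := by
      rw [div_le_div_iff₀ hx0 (by positivity)]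
      have : 0 ≤ D * r n := mul_nonneg hD (hr n)
      nlinarith
    have h5 : ((R + r n) * D + V) / (x + a) = (R * D + V) / (x + a) + r n * D / (x + a) := by
      ring
    rw [h5]
    linarith

namespace FedAvg

namespace System

theorem err_nonneg {N d : ℕ} {Ω Ξ : Type*} [MeasurableSpace Ω] [MeasurableSpace Ξ]
    (X : System N d Ω Ξ) (E : ℕ) (L μ : ℝ) (sch : Scheme) (wstar : Param d) (τ : ℕ) :
    0 ≤ X.err E L μ sch wstar τ :=
  integral_nonneg fun _ => sq_nonneg _

/-- A constant for the rates of convergence. -/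
def rateConst (E : ℕ) (L μ : ℝ) : ℝ :=
  32 * E * L / μ + 4 * (E : ℝ) ^ 2 + 256 * (E : ℝ) ^ 2 * (1 + L * E / μ) / μ ^ 2

theorem rateConst_pos {E : ℕ} (hE : 0 < E) {L μ : ℝ} (hL : 0 < L) (hμ : 0 < μ) :
    0 < rateConst E L μ := by
  unfold rateConst
  positivity

namespace Standing

variable {N d : ℕ} {Ω Ξ : Type*} [MeasurableSpace Ω] [MeasurableSpace Ξ]
  {X : System N d Ω Ξ} {E : ℕ} {L μ G : ℝ} {σ : Fin N → ℝ} {sch : Scheme} {wstar : Param d}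
  (h : X.Standing E L μ G σ sch wstar)
include h

theorem iInf_le (hμ : 0 < μ) (k : Fin N) (w : Param d) : ⨅ v, X.F k v ≤ X.F k w :=
  ciInf_le ((h.strong k).bddBelow_range hμ (h.diff k)) w

theorem gam_nonneg (hμ : 0 < μ) (k : Fin N) : 0 ≤ X.Gam wstar k :=
  sub_nonneg.2 (h.iInf_le hμ k _)

theorem gamTotal_nonneg (hμ : 0 < μ) : 0 ≤ X.GamTotal wstar :=
  sum_nonneg fun k _ => mul_nonneg (h.p_pos k).le (h.gam_nonneg hμ k)

theorem sum_meanWork_mul_gam_nonneg (hμ : 0 < μ) :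
    0 ≤ ∑ k, X.meanWork E sch 0 k * X.Gam wstar k :=
  sum_nonneg fun k _ => mul_nonneg (h.meanWork_nonneg 0 k) (h.gam_nonneg hμ k)

theorem bias_nonneg (hE : 0 < E) (hμ : 0 < μ) : 0 ≤ X.bias E μ sch wstar := by
  have := h.sum_meanWork_mul_gam_nonneg hμ
  have := h.totalWork_pos hE
  unfold bias
  positivity

/-- Obtained by inserting η = 16E/(μmx), with x = τE + γ, into `err_succ_le`. The contraction 2η ·
mμ/4 equals 8E/x, of which 2E/x is kept. The drift contributes at third order in η; 2Lη ≤ 1 reduces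
it to second order, where it joins the noise. -/
theorem err_recursion (hE : 0 < E) (hL : 0 < L) (hμ : 0 < μ) (τ : ℕ) {r : ℝ}
    (hβ : ∀ w, -(r * ∑ k, X.meanWork E sch 0 k * X.Gam wstar k) ≤
      ∑ k, X.meanWork E sch 0 k * (X.F k w - X.F k wstar)) :
    X.err E L μ sch wstar (τ + 1) ≤
      (1 - 2 * E / (τ * E + X.gam E L μ sch)) * X.err E L μ sch wstar τ +
      X.bias E μ sch wstar / 2 * r / (τ * E + X.gam E L μ sch) +
      256 * (E : ℝ) ^ 3 * (sch.theta N E + L * E / μ) * G ^ 2 / (μ ^ 2 * X.totalWork E sch) /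
        (τ * E + X.gam E L μ sch) ^ 2 := by
  have hE' : (0 : ℝ) < E := by exact_mod_cast hE
  have hm := h.totalWork_pos hE
  have hγ : 0 < X.gam E L μ sch := gam_pos hE h.pos_N hm
  have hθ := sch.one_le_theta h.pos_N hE
  have hη := h.rate_pos hE hμ τ
  have hηL : 2 * L * X.rate E L μ sch τ ≤ 1 := by
    have h1 := rate_mul_le (L := L) hE h.pos_N hμ hm τ
    have : 0 < X.rate E L μ sch τ * L := by positivity
    nlinarith
  have hrec := h.err_succ_le hE hL hμ τ hβ
  have hΔ := X.err_nonneg E L μ sch wstar τ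
  have hxη : X.rate E L μ sch τ =
      16 * E / (μ * X.totalWork E sch) / (τ * E + X.gam E L μ sch) := by
    unfold rate
    ring
  set η := X.rate E L μ sch τ
  set m := X.totalWork E sch with hmdef
  set x : ℝ := τ * E + X.gam E L μ sch with hx
  have hx0 : 0 < x := by positivity
  set B := ∑ k, X.meanWork E sch 0 k * X.Gam wstar k with hB
  set Δ := X.err E L μ sch wstar τ
  have e1 : 2 * η * (r * B) = X.bias E μ sch wstar / 2 * r / x := by
    rw [hxη]
    unfold bias
    rw [← hmdef, ← hB]
    field_simp
    ring
  have e2 : 2 * η * (m * (μ / 4) * Δ) = 8 * E / x * Δ := by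
    rw [hxη]
    field_simp
    ring
  have e3 : 2 * η * (L ^ 2 / μ * (m * (η ^ 2 * (E ^ 2 * G ^ 2)))) ≤
      η ^ 2 * (m * E * G ^ 2 * (L * E / μ)) := by
    have : η ^ 2 * (m * E * G ^ 2 * (L * E / μ)) -
        2 * η * (L ^ 2 / μ * (m * (η ^ 2 * (E ^ 2 * G ^ 2)))) =
        (1 - 2 * L * η) * (η ^ 2 * (m * E * G ^ 2 * (L * E / μ))) := by
      ring
    have h0 : 0 ≤ (1 - 2 * L * η) * (η ^ 2 * (m * E * G ^ 2 * (L * E / μ))) :=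
      mul_nonneg (by linarith) (by positivity)
    linarith
  have e4 : 256 * (E : ℝ) ^ 3 * (sch.theta N E + L * E / μ) * G ^ 2 / (μ ^ 2 * m) / x ^ 2 =
      η ^ 2 * (sch.theta N E * E * (m * G ^ 2)) + η ^ 2 * (m * E * G ^ 2 * (L * E / μ)) := by
    rw [hxη]
    field_simp
    ring
  have e5 : 2 * E / x * Δ ≤ 8 * E / x * Δ :=
    mul_le_mul_of_nonneg_right (div_le_div_of_nonneg_right (by linarith) hx0.le) hΔ
  rw [e4]
  linarith

/-- The mean squared error, with the bias weighted by the rounds in which it may occur. -/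
theorem err_le (hE : 0 < E) (hL : 0 < L) (hμ : 0 < μ) {r : ℕ → ℝ} (hr : ∀ t, 0 ≤ r t)
    (hβ : ∀ t w, -(r t * ∑ k, X.meanWork E sch 0 k * X.Gam wstar k) ≤
      ∑ k, X.meanWork E sch 0 k * (X.F k w - X.F k wstar)) (τ : ℕ) :
    X.err E L μ sch wstar τ ≤ ((∑ t ∈ range τ, r t) * X.bias E μ sch wstar +
      rateConst E L μ * ((1 + sch.theta N E) / X.totalWork E sch) *
        (G ^ 2 + X.err E L μ sch wstar 0)) / (τ * E + X.gam E L μ sch) := by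
  have hE' : (0 : ℝ) < E := by exact_mod_cast hE
  have hm := h.totalWork_pos hE
  have hγ : 0 < X.gam E L μ sch := gam_pos hE h.pos_N hm
  have hθ := sch.one_le_theta h.pos_N hE
  have hγ4 := h.four_mul_le_gam hE
  have h0 := X.err_nonneg E L μ sch wstar 0
  refine (le_div_of_recursion hE' (by linarith) (h.bias_nonneg hE hμ)
    (show 0 ≤ 256 * (E : ℝ) ^ 3 * (sch.theta N E + L * E / μ) * G ^ 2 /
      (μ ^ 2 * X.totalWork E sch) by positivity) hr h0
    (fun n => h.err_recursion hE hL hμ n (hβ n)) τ).trans ?_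
  refine div_le_div_of_nonneg_right (add_le_add_right ?_ _) (by positivity)
  set θ := sch.theta N E
  set m := X.totalWork E sch with hmdef
  set Δ := X.err E L μ sch wstar 0
  -- The first two summands of `rateConst` control the two entries of the maximum defining γ, the
  -- third controls the noise constant divided by E.
  have hγle : X.gam E L μ sch ≤ (32 * E * L / μ + 4 * (E : ℝ) ^ 2) * ((1 + θ) / m) := by
    refine max_le ?_ ?_
    · have : 32 * E * (1 + θ) * L / (μ * m) = 32 * E * L / μ * ((1 + θ) / m) := by
        field_simp
      rw [this]
      gcongr
      exact le_add_of_nonneg_right (by positivity)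
    · rw [mul_div_assoc]
      gcongr
      · exact le_add_of_nonneg_left (by positivity)
      · linarith
  have hA : 256 * (E : ℝ) ^ 3 * (θ + L * E / μ) * G ^ 2 / (μ ^ 2 * m) / E ≤
      256 * (E : ℝ) ^ 2 * (1 + L * E / μ) / μ ^ 2 * ((1 + θ) / m) * G ^ 2 := by
    have e : 256 * (E : ℝ) ^ 3 * (θ + L * E / μ) * G ^ 2 / (μ ^ 2 * m) / E =
        256 * (E : ℝ) ^ 2 / μ ^ 2 * (G ^ 2 / m) * (θ + L * E / μ) := by
      field_simp
    have e' : 256 * (E : ℝ) ^ 2 * (1 + L * E / μ) / μ ^ 2 * ((1 + θ) / m) * G ^ 2 =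
        256 * (E : ℝ) ^ 2 / μ ^ 2 * (G ^ 2 / m) * ((1 + L * E / μ) * (1 + θ)) := by
      field_simp
    rw [e, e']
    refine mul_le_mul_of_nonneg_left ?_ (by positivity)
    have : 0 ≤ L * E / μ := by positivity
    nlinarith
  have hB := mul_le_mul_of_nonneg_right hγle h0
  have hq : 0 < (1 + θ) / m := by positivity
  have hc1 : 0 ≤ (32 * E * L / μ + 4 * (E : ℝ) ^ 2) * ((1 + θ) / m) * G ^ 2 := by positivity
  have hc2 : 0 ≤ 256 * (E : ℝ) ^ 2 * (1 + L * E / μ) / μ ^ 2 * ((1 + θ) / m) * Δ := by positivity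
  unfold rateConst
  linarith

/-- The mean squared error if the mean work is proportional to the weights of the devices. -/
theorem err_le_of_proportional (hE : 0 < E) (hL : 0 < L) (hμ : 0 < μ) {c : ℝ}
    (hc : ∀ k, X.meanWork E sch 0 k = c * X.p k) {τ : ℕ} (hτ : 1 ≤ τ) :
    X.err E L μ sch wstar τ ≤ rateConst E L μ * ((1 + sch.theta N E) / X.totalWork E sch) *
        (G ^ 2 + X.err E L μ sch wstar 0) / τ := by
  have hm := h.totalWork_pos hE
  have hθ := sch.one_le_theta h.pos_N hE
  have hγ : 0 < X.gam E L μ sch := gam_pos hE h.pos_N hm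
  have h0 := X.err_nonneg E L μ sch wstar 0
  have hC := rateConst_pos hE hL hμ
  have hE' : (1 : ℝ) ≤ E := by exact_mod_cast hE
  have hτ' : (1 : ℝ) ≤ τ := by exact_mod_cast hτ
  have hc0 : 0 ≤ c := by
    have h1 := hm
    rw [h.totalWork_eq hE] at h1
    simp_rw [hc] at h1
    rw [← mul_sum, h.p_sum, mul_one] at h1
    exact h1.le
  -- With proportional mean work the weighted excess is c (F(w) - F(w*)) ≥ 0, so no bias enters.
  have h1 := h.err_le hE hL hμ (r := fun _ => 0) (fun _ => le_rfl) (fun _ w => by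
    have e : ∑ k, X.meanWork E sch 0 k * (X.F k w - X.F k wstar) =
        c * (X.globalF w - X.globalF wstar) := by
      unfold globalF
      rw [← sum_sub_distrib, mul_sum]
      exact sum_congr rfl fun k _ => by rw [hc]; ring
    rw [e, zero_mul, neg_zero]
    exact mul_nonneg hc0 (sub_nonneg.2 (h.isMin w))) τ
  refine h1.trans ?_
  simp only [sum_const_zero, zero_mul, zero_add]
  refine div_le_div_of_nonneg_left (by positivity) (by positivity) ?_
  nlinarith

/-- The mean squared error under arbitrary participation. -/
theorem exists_err_le (hE : 0 < E) (hL : 0 < L) (hμ : 0 < μ) :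
    ∃ V : ℝ, ∀ τ : ℕ, 1 ≤ τ →
      X.err E L μ sch wstar τ ≤ X.bias E μ sch wstar / E + V / τ := by
  have hm := h.totalWork_pos hE
  have hθ := sch.one_le_theta h.pos_N hE
  have hγ : 0 < X.gam E L μ sch := gam_pos hE h.pos_N hm
  have h0 := X.err_nonneg E L μ sch wstar 0
  have hC := rateConst_pos hE hL hμ
  have hD := h.bias_nonneg hE hμ
  have hE' : (1 : ℝ) ≤ E := by exact_mod_cast hE
  refine ⟨rateConst E L μ * ((1 + sch.theta N E) / X.totalWork E sch) *
        (G ^ 2 + X.err E L μ sch wstar 0), fun τ hτ => ?_⟩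
  have hτ' : (1 : ℝ) ≤ τ := by exact_mod_cast hτ
  -- Every round is charged the full bias, from F_k(w) ≥ F_k^*. The accumulated τD over τE + γ stays
  -- below D/E.
  refine (h.err_le hE hL hμ (r := fun _ => 1) (fun _ => zero_le_one) (fun _ w => ?_) τ).trans ?_
  · rw [one_mul, ← sum_neg_distrib]
    refine sum_le_sum fun k _ => ?_
    rw [← mul_neg]
    refine mul_le_mul_of_nonneg_left ?_ (h.meanWork_nonneg 0 k)
    have := h.iInf_le hμ k w
    unfold Gam
    linarith
  · rw [add_div]
    refine add_le_add ?_ (div_le_div_of_nonneg_left (by positivity) (by positivity) (by nlinarith))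
    simp only [sum_const, card_range, nsmul_eq_mul, mul_one]
    rw [div_le_div_iff₀ (by positivity) (by positivity)]
    nlinarith [mul_nonneg hD hγ.le]

end Standing

end System

end FedAvg

/-! ### Exchangeability and the individual schemes -/

/-- A conditioned law of i.i.d. variables is exchangeable if the conditioning event is. -/
theorem integral_cond_pi_comp_perm {ι α : Type*} [Fintype ι] [MeasurableSpace α] (ν : Measure α)
    [IsProbabilityMeasure ν] {S : Set (ι → α)} (hS : MeasurableSet S) (e : Equiv.Perm ι)
    (hSe : ∀ v, v ∘ e ∈ S ↔ v ∈ S) (f : (ι → α) → ℝ) :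
    ∫ v, f (v ∘ e) ∂(ProbabilityTheory.cond (Measure.pi fun _ : ι => ν) S) =
      ∫ v, f v ∂(ProbabilityTheory.cond (Measure.pi fun _ : ι => ν) S) := by
  have hmp := measurePreserving_arrowCongr' (fun _ : ι => ν) (fun _ : ι => ν) e.symm
    (MeasurableEquiv.refl α) (fun _ => MeasurePreserving.id ν)
  have happ : ∀ v : ι → α,
      MeasurableEquiv.arrowCongr' e.symm (MeasurableEquiv.refl α) v = v ∘ e := fun v => rfl
  unfold ProbabilityTheory.cond
  rw [integral_smul_measure, integral_smul_measure, ← integral_indicator hS,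
    ← integral_indicator hS, ← hmp.integral_comp' (S.indicator f)]
  congr 1
  refine integral_congr_ae (Filter.Eventually.of_forall fun v => ?_)
  simp only [happ]
  by_cases hv : v ∈ S
  · rw [Set.indicator_of_mem hv, Set.indicator_of_mem ((hSe v).2 hv)]
  · rw [Set.indicator_of_notMem hv, Set.indicator_of_notMem (mt (hSe v).1 hv)]

namespace FedAvg

theorem numComplete_comp_perm {N E : ℕ} (e : Equiv.Perm (Fin N)) (v : Fin N → ℕ) :
    numComplete E (v ∘ e) = numComplete E v := by
  simp only [numComplete, card_filter, Function.comp_apply]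
  exact Equiv.sum_comp e fun k => if v k = E then 1 else 0

namespace System

namespace Standing

variable {N d : ℕ} {Ω Ξ : Type*} [MeasurableSpace Ω] [MeasurableSpace Ξ]
  {X : System N d Ω Ξ} {E : ℕ} {L μ G : ℝ} {σ : Fin N → ℝ} {wstar : Param d}

theorem sigmaBarSq_nonneg (X : System N d Ω Ξ) (σ : Fin N → ℝ) : 0 ≤ X.sigmaBarSq σ :=
  sum_nonneg fun _ _ => sq_nonneg _

/-! ### Scheme A -/

/-- The variables N/K on complete devices, 0 on the others, sum to N almost surely. Conditioning on
K ≠ 0 preserves exchangeability, so each has mean 1, and the work of device k is E p^k times its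
variable. -/
theorem meanWork_of_homogeneousRetained (h : X.Standing E L μ G σ .A wstar)
    (hK : X.HasComplete E) (hH : X.HomogeneousRetained E) (k : Fin N) :
    X.meanWork E .A 0 k = E * X.p k := by
  have := h.prob
  obtain ⟨ν, hν, hlaw⟩ := hH 0
  set g : Fin N → (Fin N → ℕ) → ℝ := fun k v =>
    if v k = E then (N : ℝ) / numComplete E v else 0 with hg
  have hgm : ∀ k, AEStronglyMeasurable (g k) (X.P.map (X.s 0)) := fun k =>
    (Measurable.of_discrete).aestronglyMeasurable
  have hgi : ∀ k, Integrable (fun ω => g k (X.s 0 ω)) X.P := fun k => by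
    refine h.integrable_comp_s 0 (g k) N fun ω => ?_
    simp only [hg]
    split_ifs with hk
    · have : (1 : ℝ) ≤ numComplete E (X.s 0 ω) := by exact_mod_cast numComplete_pos hk
      rw [abs_of_nonneg (by positivity)]
      exact div_le_self (by positivity) this
    · simp
  have hsymm : ∀ j, ∫ ω, g j (X.s 0 ω) ∂X.P = ∫ ω, g k (X.s 0 ω) ∂X.P := by
    intro j
    rw [← integral_map (h.meas_s 0).aemeasurable (hgm j),
      ← integral_map (h.meas_s 0).aemeasurable (hgm k), hlaw,
      ← integral_cond_pi_comp_perm ν (MeasurableSet.of_discrete) (Equiv.swap j k)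
        (fun v => by simp [numComplete_comp_perm]) (g k)]
    refine integral_congr_ae (Filter.Eventually.of_forall fun v => ?_)
    simp [hg, numComplete_comp_perm]
  have hsum : ∑ j, ∫ ω, g j (X.s 0 ω) ∂X.P = N := by
    rw [← integral_finsetSum _ fun j _ => hgi j]
    have : (fun ω => ∑ j, g j (X.s 0 ω)) =ᵐ[X.P] fun _ => (N : ℝ) := by
      filter_upwards [hK 0] with ω hω
      have hne : (numComplete E (X.s 0 ω) : ℝ) ≠ 0 := by exact_mod_cast hω
      simp only [hg]
      rw [← sum_filter, sum_const, nsmul_eq_mul]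
      change (numComplete E (X.s 0 ω) : ℝ) * _ = _
      field_simp
    rw [integral_congr_ae this]
    simp
  have hone : ∫ ω, g k (X.s 0 ω) ∂X.P = 1 := by
    simp_rw [hsymm] at hsum
    rw [sum_const, card_univ, Fintype.card_fin, nsmul_eq_mul] at hsum
    have hN : (N : ℝ) ≠ 0 := by exact_mod_cast h.pos_N.ne'
    exact mul_left_cancel₀ hN (by rw [hsum, mul_one])
  have hpt : ∀ ω, Scheme.A.coef E X.p (X.s 0 ω) k * (X.s 0 ω k : ℝ) =
      E * X.p k * g k (X.s 0 ω) := by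
    intro ω
    simp only [Scheme.coef, hg]
    split_ifs with hk
    · rw [hk]; ring
    · simp
  unfold meanWork
  simp_rw [hpt]
  rw [integral_const_mul, hone, mul_one]

/-- From K ≤ N. It allows the factor θ = N of Scheme A to be absorbed into 𝔼[N²/K]. -/
theorem le_meanInvK (h : X.Standing E L μ G σ .A wstar) (hK : X.HasComplete E) (τ : ℕ) :
    (N : ℝ) ≤ X.meanInvK E τ := by
  have := h.prob
  have hi : Integrable (fun ω => (N : ℝ) ^ 2 / (numComplete E (X.s τ ω) : ℝ)) X.P := by
    refine h.integrable_comp_s τ (fun v => (N : ℝ) ^ 2 / (numComplete E v : ℝ)) (N ^ 2) fun ω => ?_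
    rw [abs_of_nonneg (by positivity)]
    -- On the null event K = 0 the quotient is 0 by convention, so the bound holds at every sample
    -- point.
    rcases Nat.eq_zero_or_pos (numComplete E (X.s τ ω)) with h0 | h0
    · rw [h0]; simp
    · exact div_le_self (by positivity) (by exact_mod_cast h0)
  have h1 : ∫ _, (N : ℝ) ∂X.P ≤ X.meanInvK E τ := by
    refine integral_mono_ae (integrable_const _) hi ?_
    filter_upwards [hK τ] with ω hω
    have hpos : (0 : ℝ) < numComplete E (X.s τ ω) := by exact_mod_cast Nat.pos_of_ne_zero hω
    have hle : (numComplete E (X.s τ ω) : ℝ) ≤ N := by exact_mod_cast numComplete_le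
    rw [le_div_iff₀ hpos]
    nlinarith
  simpa using h1

theorem err_le_schemeA (h : X.Standing E L μ G σ .A wstar) (hE : 0 < E) (hL : 0 < L) (hμ : 0 < μ)
    (hK : X.HasComplete E) (hH : X.HomogeneousRetained E) {C : ℝ}
    (hC : 2 * rateConst E L μ ≤ C) {τ : ℕ} (hτ : 1 ≤ τ) :
    X.err E L μ .A wstar τ ≤ C * (X.meanInvK E τ * (G ^ 2 + X.err E L μ .A wstar 0)
      + X.sigmaBarSq σ + X.GamTotal wstar) / τ := by
  have hw := h.meanWork_of_homogeneousRetained hK hH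
  have hm : X.totalWork E .A = E := by
    rw [h.totalWork_eq hE]
    simp_rw [hw]
    rw [← mul_sum, h.p_sum, mul_one]
  have h0 := X.err_nonneg E L μ .A wstar 0
  have hR := rateConst_pos hE hL hμ
  have hI := h.le_meanInvK hK τ
  have hσ := sigmaBarSq_nonneg X σ
  have hΓ := h.gamTotal_nonneg hμ
  have hN : (1 : ℝ) ≤ N := by exact_mod_cast h.pos_N
  have hE' : (1 : ℝ) ≤ E := by exact_mod_cast hE
  refine (h.err_le_of_proportional hE hL hμ hw hτ).trans
    (div_le_div_of_nonneg_right ?_ (Nat.cast_nonneg τ))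
  rw [hm]
  have h1 : (1 + Scheme.A.theta N E) / E ≤ 2 * X.meanInvK E τ := by
    refine (div_le_self (by simp only [Scheme.theta]; positivity) hE').trans ?_
    simp only [Scheme.theta]
    linarith
  have hI0 : 0 ≤ X.meanInvK E τ := by linarith
  calc rateConst E L μ * ((1 + Scheme.A.theta N E) / E) * (G ^ 2 + X.err E L μ .A wstar 0)
      ≤ rateConst E L μ * (2 * X.meanInvK E τ) * (G ^ 2 + X.err E L μ .A wstar 0) := by gcongr
    _ = 2 * rateConst E L μ * (X.meanInvK E τ * (G ^ 2 + X.err E L μ .A wstar 0)) := by ring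
    _ ≤ C * (X.meanInvK E τ * (G ^ 2 + X.err E L μ .A wstar 0)
      + X.sigmaBarSq σ + X.GamTotal wstar) := by
        gcongr <;> linarith

/-! ### Scheme B -/

theorem err_le_schemeB (h : X.Standing E L μ G σ .B wstar) (hE : 0 < E) (hL : 0 < L) (hμ : 0 < μ)
    (hH : X.Homogeneous) {C : ℝ} (hC : 2 * rateConst E L μ ≤ C) {τ : ℕ} (k : Fin N)
    (hτ : 1 ≤ τ) :
    X.err E L μ .B wstar τ ≤ C * (X.sigmaBarSq σ + X.GamTotal wstar + G ^ 2 +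
      X.err E L μ .B wstar 0) / (τ * X.meanS τ k) := by
  have hmk : ∀ τ k, Measurable fun ω => X.s τ ω k := fun τ k =>
    (measurable_pi_apply k).comp (h.meas_s τ)
  have hs : ∀ j, X.meanS τ j = X.meanS τ k := by
    intro j
    have e : ∀ j, X.meanS τ j = ∫ n, (n : ℝ) ∂(X.P.map fun ω => X.s τ ω j) := fun j =>
      (integral_map (hmk τ j).aemeasurable
        (Measurable.of_discrete (f := fun n : ℕ => (n : ℝ))).aestronglyMeasurable).symm
    rw [e, e, hH τ j k]
  have hw : ∀ j, X.meanWork E .B 0 j = X.meanS τ k * X.p j := by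
    intro j
    rw [← h.static τ j, ← hs j, mul_comm]
    unfold meanWork meanS
    rw [← integral_const_mul]
    rfl
  have hm : X.totalWork E .B = X.meanS τ k := by
    rw [h.totalWork_eq hE]
    simp_rw [hw]
    rw [← mul_sum, h.p_sum, mul_one]
  have hmpos := h.totalWork_pos hE
  have h0 := X.err_nonneg E L μ .B wstar 0
  have hR := rateConst_pos hE hL hμ
  have hσ := sigmaBarSq_nonneg X σ
  have hΓ := h.gamTotal_nonneg hμ
  refine (h.err_le_of_proportional hE hL hμ hw hτ).trans ?_
  rw [← hm, mul_comm (τ : ℝ), ← div_div]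
  refine div_le_div_of_nonneg_right ?_ (Nat.cast_nonneg τ)
  have e : rateConst E L μ * ((1 + Scheme.B.theta N E) / X.totalWork E .B) *
      (G ^ 2 + X.err E L μ .B wstar 0) =
      2 * rateConst E L μ * (G ^ 2 + X.err E L μ .B wstar 0) / X.totalWork E .B := by
    simp only [Scheme.theta]
    ring
  rw [e]
  gcongr <;> linarith

/-! ### Scheme C -/

section SchemeC

variable (h : X.Standing E L μ G σ .C wstar)
include h

theorem measurableSet_active (τ : ℕ) (k : Fin N) : MeasurableSet {ω | X.s τ ω k ≠ 0} :=
  ((measurable_pi_apply k).comp (h.meas_s τ)) (MeasurableSet.of_discrete (s := {n : ℕ | n ≠ 0}))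

/-- The coefficient cancels the number of updates: an active device always contributes E p^k,
however few steps it makes. -/
theorem meanWork_schemeC (τ : ℕ) (k : Fin N) :
    X.meanWork E .C τ k = E * (X.p k * X.P.real {ω | X.s τ ω k ≠ 0}) := by
  have hpt : ∀ ω, Scheme.C.coef E X.p (X.s τ ω) k * (X.s τ ω k : ℝ) =
      E * X.p k * {ω | X.s τ ω k ≠ 0}.indicator (fun _ => (1 : ℝ)) ω := by
    intro ω
    simp only [Scheme.coef, Set.indicator_apply, Set.mem_ofPred_eq]
    by_cases h0 : X.s τ ω k = 0
    · simp [h0]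
    · have : (X.s τ ω k : ℝ) ≠ 0 := by exact_mod_cast h0
      simp only [h0, if_false, ne_eq, not_false_eq_true, if_true]
      field_simp
  unfold meanWork
  simp_rw [hpt]
  rw [integral_const_mul, integral_indicator_const _ (h.measurableSet_active τ k), smul_eq_mul,
    mul_one, mul_assoc]

theorem totalWork_schemeC (hE : 0 < E) (τ : ℕ) : X.totalWork E .C = E * X.activity τ := by
  rw [h.totalWork_eq hE, activity, mul_sum]
  exact sum_congr rfl fun k _ => by rw [← h.static τ k, h.meanWork_schemeC]

theorem activity_pos (hE : 0 < E) (τ : ℕ) : 0 < X.activity τ := by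
  have h1 := h.totalWork_pos hE
  rw [h.totalWork_schemeC hE τ] at h1
  exact pos_of_mul_pos_right h1 (Nat.cast_nonneg E)

theorem theta_div_totalWork_le (hE : 0 < E) (τ : ℕ) :
    (1 + Scheme.C.theta N E) / X.totalWork E .C ≤ 2 / X.activity τ := by
  have hρ := h.activity_pos hE τ
  have hE' : (1 : ℝ) ≤ E := by exact_mod_cast hE
  rw [h.totalWork_schemeC hE τ, div_le_div_iff₀ (by positivity) hρ]
  simp only [Scheme.theta]
  nlinarith

/-- Because s ≤ E. In the homogeneous rate for Scheme C this inserts the factor 𝔼[1/s] at the cost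
of a factor E in the constant. -/
theorem one_le_mul_meanInvS {τ : ℕ} {k : Fin N} (hk : 0 < X.P.real {ω | X.s τ ω k ≠ 0}) :
    1 ≤ E * X.meanInvS τ k := by
  have := h.prob
  have hne : X.P {ω | X.s τ ω k ≠ 0} ≠ 0 := fun h0 => by simp [measureReal_def, h0] at hk
  have := cond_isProbabilityMeasure hne
  have hpt : ∀ᵐ ω ∂(ProbabilityTheory.cond X.P {ω | X.s τ ω k ≠ 0}), (1 : ℝ) ≤ E * (1 / (X.s τ ω k : ℝ)) := by
    filter_upwards [ae_cond_mem (h.measurableSet_active τ k)] with ω hω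
    have h1 : (0 : ℝ) < X.s τ ω k := by exact_mod_cast Nat.pos_of_ne_zero hω
    have h2 : (X.s τ ω k : ℝ) ≤ E := by exact_mod_cast h.s_le τ ω k
    rw [mul_one_div, le_div_iff₀ h1, one_mul]
    exact h2
  have hm : Measurable fun ω => 1 / (X.s τ ω k : ℝ) :=
    (Measurable.of_discrete (f := fun n : ℕ => 1 / (n : ℝ))).comp
      ((measurable_pi_apply k).comp (h.meas_s τ))
  have hi : Integrable (fun ω => E * (1 / (X.s τ ω k : ℝ))) (ProbabilityTheory.cond X.P {ω | X.s τ ω k ≠ 0}) := by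
    refine (Integrable.of_bound hm.aestronglyMeasurable 1
      (Filter.Eventually.of_forall fun ω => ?_)).const_mul _
    rw [Real.norm_of_nonneg (by positivity)]
    rcases Nat.eq_zero_or_pos (X.s τ ω k) with h0 | h0
    · rw [h0]; simp
    · exact div_le_self zero_le_one (by exact_mod_cast h0)
  have h1 := integral_mono_ae (integrable_const (1 : ℝ)) hi hpt
  rw [integral_const_mul] at h1
  simpa [meanInvS] using h1

theorem err_le_schemeC_of_homogeneous (hE : 0 < E) (hL : 0 < L) (hμ : 0 < μ)
    (hH : X.Homogeneous) {C : ℝ} (hC : 2 * rateConst E L μ * E ≤ C) {τ : ℕ} (k : Fin N)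
    (hτ : 1 ≤ τ) :
    X.err E L μ .C wstar τ ≤ C * (X.sigmaBarSq σ + X.GamTotal wstar + G ^ 2 +
      X.err E L μ .C wstar 0) / (τ * X.activity τ * (X.meanInvS τ k)⁻¹) := by
  have hq : ∀ j, X.P.real {ω | X.s τ ω j ≠ 0} = X.P.real {ω | X.s τ ω k ≠ 0} := by
    intro j
    have e : ∀ j, X.P {ω | X.s τ ω j ≠ 0} = (X.P.map fun ω => X.s τ ω j) {n | n ≠ 0} := fun j =>
      (Measure.map_apply ((measurable_pi_apply j).comp (h.meas_s τ))
        (MeasurableSet.of_discrete (s := {n : ℕ | n ≠ 0}))).symm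
    rw [measureReal_def, measureReal_def, e, e, hH τ j k]
  have hρ : X.activity τ = X.P.real {ω | X.s τ ω k ≠ 0} := by
    unfold activity
    simp_rw [hq]
    rw [← sum_mul, h.p_sum, one_mul]
  have hρ0 := h.activity_pos hE τ
  have hw : ∀ j, X.meanWork E .C 0 j = E * X.activity τ * X.p j := by
    intro j
    rw [← h.static τ j, h.meanWork_schemeC, hq, hρ]
    ring
  have hI : 1 ≤ E * X.meanInvS τ k := h.one_le_mul_meanInvS (hρ ▸ hρ0)
  have h0 := X.err_nonneg E L μ .C wstar 0
  have hR := rateConst_pos hE hL hμ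
  have hσ := sigmaBarSq_nonneg X σ
  have hΓ := h.gamTotal_nonneg hμ
  have hE' : (0 : ℝ) < E := by exact_mod_cast hE
  have hI0 : 0 ≤ X.meanInvS τ k := (pos_of_mul_pos_right (zero_lt_one.trans_le hI) hE'.le).le
  refine (h.err_le_of_proportional hE hL hμ hw hτ).trans ?_
  rw [mul_assoc (τ : ℝ), mul_comm (τ : ℝ), ← div_div]
  refine div_le_div_of_nonneg_right ?_ (Nat.cast_nonneg τ)
  rw [← div_div, div_inv_eq_mul]
  have hC0 : 0 ≤ C := le_trans (by positivity) hC
  have hΔ : 0 ≤ G ^ 2 + X.err E L μ .C wstar 0 := by positivity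
  calc rateConst E L μ * ((1 + Scheme.C.theta N E) / X.totalWork E .C) *
        (G ^ 2 + X.err E L μ .C wstar 0)
      ≤ rateConst E L μ * (2 / X.activity τ) * (G ^ 2 + X.err E L μ .C wstar 0) :=
        mul_le_mul_of_nonneg_right
          (mul_le_mul_of_nonneg_left (h.theta_div_totalWork_le hE τ) hR.le) hΔ
    _ = 2 * rateConst E L μ * (G ^ 2 + X.err E L μ .C wstar 0) / X.activity τ * 1 := by ring
    _ ≤ 2 * rateConst E L μ * (G ^ 2 + X.err E L μ .C wstar 0) / X.activity τ *
        (E * X.meanInvS τ k) := by gcongr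
    _ = 2 * rateConst E L μ * E * (G ^ 2 + X.err E L μ .C wstar 0) / X.activity τ *
        X.meanInvS τ k := by ring
    _ ≤ _ := by
        gcongr
        linarith

/-- Let q_k be the probability that device k is active and r = 𝔼[I_τ], so q_k ≥ 1 - r. Split q_k =
(1 - r) + (q_k - 1 + r). The first part weights the devices by p^k and gives a nonnegative multiple
of F(w) - F(w*). The second loses at most (q_k - 1 + r) Γ_k, which is at most r q_k Γ_k since the
difference is (1 - r)(1 - q_k) Γ_k ≥ 0. -/
theorem neg_meanInactive_mul_le (hμ : 0 < μ) (τ : ℕ) (w : Param d) :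
    -(X.meanInactive τ * ∑ k, X.meanWork E .C 0 k * X.Gam wstar k) ≤
      ∑ k, X.meanWork E .C 0 k * (X.F k w - X.F k wstar) := by
  have := h.prob
  set r := X.meanInactive τ with hr
  set q : Fin N → ℝ := fun k => X.P.real {ω | X.s τ ω k ≠ 0} with hq
  have hr1 : r ≤ 1 := measureReal_le_one
  have hq1 : ∀ k, q k ≤ 1 := fun k => measureReal_le_one
  have hqr : ∀ k, 0 ≤ q k - 1 + r := by
    intro k
    have h1 : X.P.real {ω | X.s τ ω k ≠ 0}ᶜ ≤ r :=
      measureReal_mono (fun ω hω => ⟨k, by simpa using hω⟩)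
    rw [probReal_compl_eq_one_sub (h.measurableSet_active τ k)] at h1
    simp only [hq]
    linarith
  have hw : ∀ k, X.meanWork E .C 0 k = E * (X.p k * q k) := fun k => by
    rw [← h.static τ k, h.meanWork_schemeC]
  have hopt : 0 ≤ ∑ k, X.p k * (X.F k w - X.F k wstar) := by
    simp_rw [mul_sub]
    rw [sum_sub_distrib]
    exact sub_nonneg.2 (h.isMin w)
  have hterm : ∀ k, (E : ℝ) * ((1 - r) * (X.p k * (X.F k w - X.F k wstar))) -
      r * (X.meanWork E .C 0 k * X.Gam wstar k) ≤
      X.meanWork E .C 0 k * (X.F k w - X.F k wstar) := by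
    intro k
    have hΓ := h.gam_nonneg hμ k
    have hy : 0 ≤ X.F k w - X.F k wstar + X.Gam wstar k := by
      have := h.iInf_le hμ k w
      unfold Gam
      linarith
    have hp := (h.p_pos k).le
    have h1 : 0 ≤ X.p k * ((q k - 1 + r) * (X.F k w - X.F k wstar + X.Gam wstar k)) :=
      mul_nonneg hp (mul_nonneg (hqr k) hy)
    have h2 : 0 ≤ X.p k * ((1 - r) * (1 - q k) * X.Gam wstar k) :=
      mul_nonneg hp (mul_nonneg (mul_nonneg (by linarith) (by linarith [hq1 k])) hΓ)
    have h3 : 0 ≤ (E : ℝ) * (X.p k * ((q k - 1 + r) * (X.F k w - X.F k wstar + X.Gam wstar k)) +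
        X.p k * ((1 - r) * (1 - q k) * X.Gam wstar k)) := by positivity
    rw [hw]
    linarith
  have hsum := sum_le_sum fun k (_ : k ∈ univ) => hterm k
  rw [sum_sub_distrib, ← mul_sum, ← mul_sum, ← mul_sum] at hsum
  have : 0 ≤ (E : ℝ) * ((1 - r) * ∑ k, X.p k * (X.F k w - X.F k wstar)) :=
    mul_nonneg (Nat.cast_nonneg E) (mul_nonneg (by linarith) hopt)
  linarith

theorem err_le_schemeC (hE : 0 < E) (hL : 0 < L) (hμ : 0 < μ) {C : ℝ}
    (hC : 2 * rateConst E L μ ≤ C) (hC1 : 1 ≤ C) {τ : ℕ} (hτ : 1 ≤ τ) :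
    X.err E L μ .C wstar τ ≤
      C * ((∑ t ∈ Finset.range τ, X.meanInactive t) * X.bias E μ .C wstar
        + ((∑ k, (X.p k * σ k) ^ 2 * X.meanInvS τ k) + X.GamTotal wstar
          + G ^ 2 + X.err E L μ .C wstar 0) / X.activity τ) / τ := by
  have hρ := h.activity_pos hE τ
  have hm := h.totalWork_pos hE
  have h0 := X.err_nonneg E L μ .C wstar 0
  have hR := rateConst_pos hE hL hμ
  have hΓ := h.gamTotal_nonneg hμ
  have hγ : 0 < X.gam E L μ .C := gam_pos hE h.pos_N hm
  have hD := h.bias_nonneg hE hμ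
  have hE' : (1 : ℝ) ≤ E := by exact_mod_cast hE
  have hτ' : (1 : ℝ) ≤ τ := by exact_mod_cast hτ
  have hr : ∀ t, 0 ≤ X.meanInactive t := fun t => measureReal_nonneg
  have hM : 0 ≤ ∑ t ∈ range τ, X.meanInactive t := sum_nonneg fun t _ => hr t
  have hσ : 0 ≤ ∑ k, (X.p k * σ k) ^ 2 * X.meanInvS τ k :=
    sum_nonneg fun k _ => mul_nonneg (sq_nonneg _) (integral_nonneg fun ω => by positivity)
  have hθ : 0 ≤ Scheme.C.theta N E := by simp [Scheme.theta]
  refine (h.err_le hE hL hμ hr (fun t w => h.neg_meanInactive_mul_le hμ t w) τ).trans ?_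
  refine (div_le_div_of_nonneg_left (c := (τ : ℝ)) (by positivity) (by positivity)
    (by nlinarith)).trans ?_
  refine div_le_div_of_nonneg_right ?_ (Nat.cast_nonneg τ)
  rw [mul_add C]
  refine add_le_add (le_mul_of_one_le_left (mul_nonneg hM hD) hC1) ?_
  calc rateConst E L μ * ((1 + Scheme.C.theta N E) / X.totalWork E .C) *
        (G ^ 2 + X.err E L μ .C wstar 0)
      ≤ rateConst E L μ * (2 / X.activity τ) * (G ^ 2 + X.err E L μ .C wstar 0) :=
        mul_le_mul_of_nonneg_right
          (mul_le_mul_of_nonneg_left (h.theta_div_totalWork_le hE τ) hR.le) (by positivity)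
    _ = 2 * rateConst E L μ * ((G ^ 2 + X.err E L μ .C wstar 0) / X.activity τ) := by ring
    _ ≤ _ := by
        gcongr
        linarith

end SchemeC

end Standing

end System

end FedAvg

/-! ### A deterministic system with persistent bias -/

/-- Under a Dirac measure all families of functions are independent. -/
theorem iIndepFun_dirac {Ω ι : Type*} [MeasurableSpace Ω] [MeasurableSingletonClass Ω] (a : Ω)
    {β : ι → Type*} [∀ i, MeasurableSpace (β i)] (f : ∀ i, Ω → β i) :
    iIndepFun f (Measure.dirac a) := by
  rw [iIndepFun_iff_measure_inter_preimage_eq_mul]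
  intro S sets _
  simp only [Measure.dirac_apply]
  by_cases h : ∀ i ∈ S, f i a ∈ sets i
  · rw [Set.indicator_of_mem (by simpa using h), prod_congr rfl fun i hi =>
      Set.indicator_of_mem (show a ∈ f i ⁻¹' sets i from h i hi) (1 : Ω → ENNReal)]
    simp
  · rw [Set.indicator_of_notMem (by simpa using h)]
    push Not at h
    obtain ⟨i, hi, hia⟩ := h
    have h0 : (f i ⁻¹' sets i).indicator (1 : Ω → ENNReal) a = 0 :=
      Set.indicator_of_notMem (show a ∉ f i ⁻¹' sets i from hia) _
    exact (prod_eq_zero hi h0).symm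

section Quadratic

variable {V : Type*} [NormedAddCommGroup V] [InnerProductSpace ℝ V]

theorem hasGradientAt_half_mul_norm_sub_sq [CompleteSpace V] (μ : ℝ) (c x : V) :
    HasGradientAt (fun w => μ / 2 * ‖w - c‖ ^ 2) (μ • (x - c)) x := by
  rw [hasGradientAt_iff_hasFDerivAt]
  have h := (((hasFDerivAt_id x).sub_const c).norm_sq).const_mul (μ / 2)
  refine h.congr_fderiv ?_
  ext v
  simp
  ring

theorem strongConvexOn_half_mul_norm_sub_sq (μ : ℝ) (c : V) :
    StrongConvexOn Set.univ μ (fun w => μ / 2 * ‖w - c‖ ^ 2) := by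
  refine ⟨convex_univ, fun x _ y _ a b _ _ hab => le_of_eq ?_⟩
  have e1 : a • x + b • y - c = a • (x - c) + b • (y - c) := by
    have : c = (a + b) • c := by rw [hab, one_smul]
    rw [smul_sub, smul_sub]
    nth_rewrite 1 [this]
    rw [add_smul]
    abel
  have e2 : x - y = (x - c) - (y - c) := by abel
  simp only [smul_eq_mul]
  rw [e1, e2, norm_add_sq_real, norm_sub_sq_real (x - c) (y - c), norm_smul, norm_smul, mul_pow, mul_pow,
    real_inner_smul_left, real_inner_smul_right, Real.norm_eq_abs, Real.norm_eq_abs, sq_abs, sq_abs]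
  obtain rfl : b = 1 - a := by linarith
  ring

end Quadratic

namespace FedAvg

namespace Biased

/-- The unit vector of the line. -/
def unitVec : Param 1 := EuclideanSpace.single 0 1

theorem norm_unitVec : ‖unitVec‖ = 1 := by simp [unitVec]

/-- The minimizers of the local objectives. -/
def center (k : Fin 2) : Param 1 := if k = 0 then 0 else unitVec

/-- Two quadratic objectives with different minimizers; the first device performs all `E` updates
of each round, the second device only one. -/
def system (E : ℕ) (μ : ℝ) : System 2 1 Unit Unit where
  P := Measure.dirac ()
  F k w := μ / 2 * ‖w - center k‖ ^ 2
  p _ := 1 / 2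
  sgrad k w _ := μ • (w - center k)
  batch _ _ _ := ()
  s _ _ k := if k = 0 then E else 1
  w0 _ := 0

variable {E : ℕ} {L μ : ℝ} {sch : Scheme}

theorem gradient_F (k : Fin 2) (w : Param 1) :
    gradient ((system E μ).F k) w = μ • (w - center k) :=
  (hasGradientAt_half_mul_norm_sub_sq μ (center k) w).gradient

/-- Gradient descent on a quadratic contracts the distance to its centre by the factor 1 - ημ at
each step. -/
theorem localIter_eq (η : ℝ) (k : Fin 2) (w : Param 1) (b : ℕ → Unit) (n : ℕ) :
    (system E μ).localIter η k w b n = center k + (1 - η * μ) ^ n • (w - center k) := by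
  induction n with
  | zero => simp [System.localIter]
  | succ n ih =>
    rw [System.localIter, ih]
    simp only [system]
    module

theorem numComplete_s (hE : 2 ≤ E) (τ : ℕ) (ω : Unit) :
    numComplete E ((system E μ).s τ ω) = 1 := by
  have h1 : (1 : ℕ) ≠ E := by omega
  rw [numComplete, card_eq_one]
  refine ⟨0, ?_⟩
  ext k
  fin_cases k <;> simp [system, h1]

theorem coef_A_zero (hE : 2 ≤ E) (τ : ℕ) (ω : Unit) :
    Scheme.A.coef E (system E μ).p ((system E μ).s τ ω) 0 = 1 := by
  simp only [Scheme.coef, numComplete_s hE]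
  simp [system]

theorem coef_A_one (hE : 2 ≤ E) (τ : ℕ) (ω : Unit) :
    Scheme.A.coef E (system E μ).p ((system E μ).s τ ω) 1 = 0 := by
  have h1 : (1 : ℕ) ≠ E := by omega
  simp [Scheme.coef, system, h1]

theorem totalWork_pos (hE : 2 ≤ E) (hsch : sch = .A ∨ sch = .B) :
    0 < (system E μ).totalWork E sch := by
  have hE' : (0 : ℝ) < E := by exact_mod_cast (by omega : 0 < E)
  have hint : (system E μ).totalWork E sch = ∑ k, sch.coef E (system E μ).p
      ((system E μ).s 0 ()) k * ((system E μ).s 0 () k : ℝ) := integral_dirac _ ()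
  rw [hint, Fin.sum_univ_two]
  rcases hsch with rfl | rfl
  · rw [coef_A_zero hE, coef_A_one hE]
    simpa [system] using hE'
  · simp only [Scheme.coef, system]
    simp
    positivity

/-- The learning rate is small compared to the curvature. -/
theorem rate_mul_mem (hE : 2 ≤ E) (hμ : 0 < μ) (hμL : μ ≤ L) (hsch : sch = .A ∨ sch = .B) (τ : ℕ) :
    0 < (system E μ).rate E L μ sch τ * μ ∧ (system E μ).rate E L μ sch τ * μ ≤ 1 / 4 := by
  have hE0 : 0 < E := by omega
  have hm : 0 < (system E μ).totalWork E sch := totalWork_pos hE hsch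
  -- θ ≥ 1 makes 2(1 + θ) at least 4, whence the bound 1/4.
  have hθ := sch.one_le_theta (N := 2) (by norm_num) hE0
  have h1 := System.rate_mul_le (L := L) hE0 (by norm_num) hμ hm τ
  have h2 := System.rate_pos_of_totalWork_pos (L := L) hE0 (by norm_num) hμ hm τ
  refine ⟨mul_pos h2 hμ, ?_⟩
  have h3 : (system E μ).rate E L μ sch τ * μ ≤ (system E μ).rate E L μ sch τ * L :=
    mul_le_mul_of_nonneg_left hμL h2.le
  have h4 : 0 ≤ (system E μ).rate E L μ sch τ * L := h3.trans' (mul_pos h2 hμ).le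
  nlinarith

/-- The run stays away from the minimizer `unitVec / 2` of the global objective. -/
theorem exists_globalW_eq (hE : 2 ≤ E) (hμ : 0 < μ) (hμL : μ ≤ L) (hsch : sch = .A ∨ sch = .B)
    (τ : ℕ) (ω : Unit) :
    ∃ x : ℝ, 0 ≤ x ∧ x ≤ 2 / 5 ∧ (system E μ).globalW E L μ sch τ ω = x • unitVec := by
  induction τ with
  | zero => exact ⟨0, le_rfl, by norm_num, by simp [System.globalW, system]⟩
  | succ τ ih =>
    obtain ⟨x, hx0, hx1, hx⟩ := ih
    obtain ⟨hv0, hv1⟩ := rate_mul_mem (L := L) hE hμ hμL hsch τ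
    have hs0 : (system E μ).s τ ω 0 = E := rfl
    have hs1 : (system E μ).s τ ω 1 = 1 := rfl
    have hc0 : center 0 = 0 := rfl
    have hc1 : center 1 = unitVec := rfl
    rw [System.globalW, hx, Fin.sum_univ_two, localIter_eq, localIter_eq, hs0, hs1, hc0, hc1]
    set v := (system E μ).rate E L μ sch τ * μ
    have hu0 : 0 ≤ (1 - v) ^ E := pow_nonneg (by linarith) E
    have hu1 : (1 - v) ^ E ≤ (1 - v) ^ 2 := pow_le_pow_of_le_one (by linarith) (by linarith) hE
    rcases hsch with rfl | rfl
    -- Under Scheme A only the first device is complete, and it pulls towards its own centre 0.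
    · refine ⟨(1 - v) ^ E * x, by positivity, ?_, ?_⟩
      · refine (mul_le_of_le_one_left hx0 ?_).trans hx1
        exact pow_le_one₀ (by linarith) (by linarith)
      · rw [coef_A_zero hE, coef_A_one hE]
        module
    -- Under Scheme B two or more steps towards 0 outweigh one step towards 1. At x = 2/5 and E = 2
    -- the new value is 2/5 - v(1 - 2v)/10, so [0, 2/5] is invariant for v ≤ 1/2.
    · refine ⟨1 / 2 * ((1 - v) ^ E * x) + 1 / 2 * (v + (1 - v) * x), ?_, ?_, ?_⟩
      · have : 0 ≤ (1 - v) * x := mul_nonneg (by linarith) hx0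
        positivity
      · have h1 : (1 - v) ^ E * x ≤ (1 - v) ^ 2 * (2 / 5) :=
          mul_le_mul hu1 hx1 hx0 (sq_nonneg _)
        have h2 : (1 - v) * x ≤ (1 - v) * (2 / 5) :=
          mul_le_mul_of_nonneg_left hx1 (by linarith)
        nlinarith
      · have hB : ∀ k, Scheme.B.coef E (system E μ).p ((system E μ).s τ ω) k = 1 / 2 :=
          fun _ => rfl
        rw [hB, hB]
        module

theorem stochGrad_eq_fullGrad (t : ℕ) (k : Fin 2) (ω : Unit) :
    (system E μ).stochGrad E L μ sch t k ω = (system E μ).fullGrad E L μ sch t k ω := by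
  rw [System.fullGrad, gradient_F]
  rfl

/-- The global weight is within distance 1 of both centres and local steps only contract, so G = μ
is admissible. -/
theorem norm_stochGrad_sq_le (hE : 2 ≤ E) (hμ : 0 < μ) (hμL : μ ≤ L) (hsch : sch = .A ∨ sch = .B)
    (t : ℕ) (k : Fin 2) (ω : Unit) :
    ‖(system E μ).stochGrad E L μ sch t k ω‖ ^ 2 ≤ μ ^ 2 := by
  obtain ⟨x, hx0, hx1, hx⟩ := exists_globalW_eq (L := L) hE hμ hμL hsch (t / E) ω
  obtain ⟨hv0, hv1⟩ := rate_mul_mem (L := L) hE hμ hμL hsch (t / E)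
  have e : (system E μ).stochGrad E L μ sch t k ω =
      μ • ((1 - (system E μ).rate E L μ sch (t / E) * μ) ^ (t % E) •
        (x • unitVec - center k)) := by
    rw [stochGrad_eq_fullGrad, System.fullGrad, gradient_F, System.localW, localIter_eq, hx,
      add_sub_cancel_left]
  have hc : ‖x • unitVec - center k‖ ≤ 1 := by
    unfold center
    split_ifs
    · rw [sub_zero, norm_smul, norm_unitVec, mul_one, Real.norm_eq_abs, abs_le]
      constructor <;> linarith
    · rw [show x • unitVec - unitVec = (x - 1) • unitVec by module, norm_smul, norm_unitVec,
        mul_one, Real.norm_eq_abs, abs_le]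
      constructor <;> linarith
  refine pow_le_pow_left₀ (norm_nonneg _) ?_ 2
  rw [e, norm_smul, norm_smul, Real.norm_of_nonneg hμ.le,
    Real.norm_of_nonneg (pow_nonneg (by linarith) _)]
  refine mul_le_of_le_one_right hμ.le (mul_le_one₀ ?_ (norm_nonneg _) hc)
  exact pow_le_one₀ (by linarith) (by linarith)

theorem standing (hE : 2 ≤ E) (hμ : 0 < μ) (hμL : μ ≤ L) (hsch : sch = .A ∨ sch = .B) :
    (system E μ).Standing E L μ μ (fun _ => 0) sch ((1 / 2 : ℝ) • unitVec) where
  prob := Measure.dirac.isProbabilityMeasure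
  p_pos _ := by simp [system]
  p_sum := by simp [system]
  diff k w := (hasGradientAt_half_mul_norm_sub_sq μ (center k) w).differentiableAt
  smooth k x y := by
    rw [gradient_F, gradient_F, ← smul_sub, sub_sub_sub_cancel_right, norm_smul,
      Real.norm_of_nonneg hμ.le]
    exact mul_le_mul_of_nonneg_right hμL (norm_nonneg _)
  strong k := strongConvexOn_half_mul_norm_sub_sq μ (center k)
  isMin w := by
    have e : ∀ w, (system E μ).globalF w =
        1 / 2 * (μ / 2 * ‖w‖ ^ 2) + 1 / 2 * (μ / 2 * ‖w - unitVec‖ ^ 2) := fun w => by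
      simp [System.globalF, system, center]
    have h1 : (1 / 2 : ℝ) • unitVec - unitVec = (-1 / 2 : ℝ) • unitVec := by module
    -- The excess of the global objective over its value at the midpoint is μ/8 times this square.
    have h2 : 0 ≤ ‖(2 : ℝ) • w - unitVec‖ ^ 2 := sq_nonneg _
    rw [norm_sub_sq_real, norm_smul, real_inner_smul_left, norm_unitVec] at h2
    rw [e, e, h1, norm_smul, norm_smul, norm_sub_sq_real, norm_unitVec]
    norm_num at h2 ⊢
    nlinarith
  meas_sgrad k := by
    have : Function.uncurry ((system E μ).sgrad k) =
        fun z : Param 1 × Unit => μ • (z.1 - center k) := rfl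
    rw [this]
    fun_prop
  meas_batch _ _ := measurable_const
  meas_s _ := measurable_const
  meas_w0 := measurable_const
  memLp_w0 :=
    have : IsProbabilityMeasure (system E μ).P := Measure.dirac.isProbabilityMeasure
    memLp_const _
  s_le τ ω k := by
    simp only [system]
    split_ifs <;> omega
  unbiased k t w := by
    have : IsProbabilityMeasure (system E μ).P := Measure.dirac.isProbabilityMeasure
    rw [gradient_F]
    refine ⟨integrable_const (μ • (w - center k)), ?_⟩
    exact (integral_const (μ • (w - center k))).trans (by simp)
  indep_batch := iIndepFun_dirac () _
  indep_s := iIndepFun_dirac () _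
  indep_s_batch :=
    have : IsProbabilityMeasure (system E μ).P := Measure.dirac.isProbabilityMeasure
    indepFun_const_left (fun (_ : ℕ) (k : Fin 2) => if k = 0 then E else 1) _
  indep_w0 :=
    have : IsProbabilityMeasure (system E μ).P := Measure.dirac.isProbabilityMeasure
    indepFun_const_left _ _
  static _ _ := rfl
  work_ne := (totalWork_pos hE hsch).ne'
  variance k t := by
    simp [stochGrad_eq_fullGrad]
  second_moment k t := by
    have : IsProbabilityMeasure (system E μ).P := Measure.dirac.isProbabilityMeasure
    refine ⟨Integrable.of_finite, ?_⟩
    exact (integral_dirac _ ()).trans_le (norm_stochGrad_sq_le hE hμ hμL hsch t k ())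

theorem le_err (hE : 2 ≤ E) (hμ : 0 < μ) (hμL : μ ≤ L) (hsch : sch = .A ∨ sch = .B) (τ : ℕ) :
    1 / 100 ≤ (system E μ).err E L μ sch ((1 / 2 : ℝ) • unitVec) τ := by
  obtain ⟨x, hx0, hx1, hx⟩ := exists_globalW_eq (L := L) hE hμ hμL hsch τ ()
  have e : (system E μ).err E L μ sch ((1 / 2 : ℝ) • unitVec) τ =
      ‖(system E μ).globalW E L μ sch τ () - (1 / 2 : ℝ) • unitVec‖ ^ 2 := integral_dirac _ ()
  rw [e, hx, ← sub_smul, norm_smul, norm_unitVec, mul_one, Real.norm_eq_abs, sq_abs]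
  nlinarith

end Biased

end FedAvg

end

/-! ### The corollary -/

theorem corollary4p1 (E : ℕ) (hE : 0 < E) (L μ : ℝ) (hL : 0 < L) (hμ : 0 < μ) :
    -- the hidden constant of all the rates depends on `E`, `L`, `μ` only
    (∃ C : ℝ, 0 < C ∧
      ∀ (N d : ℕ) (Ω Ξ : Type*) [MeasurableSpace Ω] [MeasurableSpace Ξ]
        (X : FedAvg.System N d Ω Ξ) (G : ℝ) (σ : Fin N → ℝ) (wstar : FedAvg.Param d),
        -- the mean squared errors are honest expectations
        (∀ sch : FedAvg.Scheme, X.Standing E L μ G σ sch wstar →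
          ∀ τ, MeasureTheory.Integrable
            (fun ω => ‖X.globalW E L μ sch τ ω - wstar‖ ^ 2) X.P) ∧
        -- Scheme A, homogeneous
        (X.Standing E L μ G σ .A wstar → X.HasComplete E → X.HomogeneousRetained E →
          ∀ τ, 1 ≤ τ → X.err E L μ .A wstar τ ≤
            C * (X.meanInvK E τ * (G ^ 2 + X.err E L μ .A wstar 0)
              + X.sigmaBarSq σ + X.GamTotal wstar) / τ) ∧
        -- Scheme A, heterogeneous
        (X.Standing E L μ G σ .A wstar → X.HasComplete E →
          ∃ V : ℝ, ∀ τ : ℕ, 1 ≤ τ →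
            X.err E L μ .A wstar τ ≤ X.bias E μ .A wstar / E + V / τ) ∧
        -- Scheme B, homogeneous
        (X.Standing E L μ G σ .B wstar → X.Homogeneous →
          ∀ τ k, 1 ≤ τ → X.err E L μ .B wstar τ ≤
            C * (X.sigmaBarSq σ + X.GamTotal wstar + G ^ 2 + X.err E L μ .B wstar 0)
              / (τ * X.meanS τ k)) ∧
        -- Scheme B, heterogeneous
        (X.Standing E L μ G σ .B wstar →
          ∃ V : ℝ, ∀ τ : ℕ, 1 ≤ τ →
            X.err E L μ .B wstar τ ≤ X.bias E μ .B wstar / E + V / τ) ∧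
        -- Scheme C, homogeneous
        (X.Standing E L μ G σ .C wstar → X.Homogeneous →
          ∀ τ k, 1 ≤ τ → X.err E L μ .C wstar τ ≤
            C * (X.sigmaBarSq σ + X.GamTotal wstar + G ^ 2 + X.err E L μ .C wstar 0)
              / (τ * X.activity τ * (X.meanInvS τ k)⁻¹)) ∧
        -- Scheme C, heterogeneous
        (X.Standing E L μ G σ .C wstar → (∀ τ k, X.meanS τ k ≠ 0) →
          ∀ τ, 1 ≤ τ → X.err E L μ .C wstar τ ≤
            C * ((∑ t ∈ Finset.range τ, X.meanInactive t) * X.bias E μ .C wstar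
              + ((∑ k, (X.p k * σ k) ^ 2 * X.meanInvS τ k) + X.GamTotal wstar
                  + G ^ 2 + X.err E L μ .C wstar 0) / X.activity τ) / τ)) ∧
    -- the bias of Schemes A and B need not vanish, even if all devices are always active
    (2 ≤ E → μ ≤ L → ∀ sch : FedAvg.Scheme, sch = .A ∨ sch = .B →
      ∃ (N d : ℕ) (X : FedAvg.System N d Unit Unit) (G : ℝ) (σ : Fin N → ℝ)
        (wstar : FedAvg.Param d),
        X.Standing E L μ G σ sch wstar ∧ X.HasComplete E ∧ (∀ τ ω k, X.s τ ω k ≠ 0) ∧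
        ∃ δ : ℝ, 0 < δ ∧ ∀ τ, δ ≤ X.err E L μ sch wstar τ) := by
  -- The factor E serves the homogeneous rate of Scheme C; the summand 1 makes C ≥ 1, needed in
  -- front of the accumulated bias of its heterogeneous rate.
  refine ⟨⟨2 * FedAvg.System.rateConst E L μ * E + 1, ?_, ?_⟩, ?_⟩
  · have := FedAvg.System.rateConst_pos hE hL hμ
    positivity
  · intro N d Ω Ξ _ _ X G σ wstar
    have hR := FedAvg.System.rateConst_pos hE hL hμ
    have hE' : (1 : ℝ) ≤ E := by exact_mod_cast hE
    have hC1 : 2 * FedAvg.System.rateConst E L μ * E ≤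
        2 * FedAvg.System.rateConst E L μ * E + 1 := by linarith
    have hC2 : 2 * FedAvg.System.rateConst E L μ ≤
        2 * FedAvg.System.rateConst E L μ * E + 1 := by nlinarith
    have hC3 : 1 ≤ 2 * FedAvg.System.rateConst E L μ * E + 1 :=
      le_add_of_nonneg_left (by positivity)
    exact ⟨fun sch h τ => h.integrable_err hE τ,
      fun h hK hH τ hτ => h.err_le_schemeA hE hL hμ hK hH hC2 hτ,
      fun h _ => h.exists_err_le hE hL hμ,
      fun h hH τ k hτ => h.err_le_schemeB hE hL hμ hH hC2 k hτ,
      fun h => h.exists_err_le hE hL hμ,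
      fun h hH τ k hτ => h.err_le_schemeC_of_homogeneous hE hL hμ hH hC1 k hτ,
      fun h _ τ hτ => h.err_le_schemeC hE hL hμ hC2 hC3 hτ⟩
  · intro hE2 hμL sch hsch
    refine ⟨2, 1, FedAvg.Biased.system E μ, μ, fun _ => 0, (1 / 2 : ℝ) • FedAvg.Biased.unitVec,
      FedAvg.Biased.standing hE2 hμ hμL hsch,
      fun τ => Filter.Eventually.of_forall fun ω => ?_, fun τ ω k => ?_,
      1 / 100, by norm_num, FedAvg.Biased.le_err hE2 hμ hμL hsch⟩
    · rw [FedAvg.Biased.numComplete_s hE2]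
      exact one_ne_zero
    · simp only [FedAvg.Biased.system]
      split_ifs
      exacts [hE.ne', one_ne_zero]
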